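/- **Setting.** Consider $N$ nodes and $M$ edges with $$\dot x_i=A_ix_i+B_iu_i+D_iv_i,\quad y_i=C_ix_i\quad(1\le i\le N),\qquad \dot z_j=E_jz_j+F_js_j,\quad w_j=G_jz_j\quad(1\le j\le M),$$ with real matrices, $x_i\in\mathbb R^{n_i}$, $u_i\in\mathbb R^{m_i}$, $z_j\in\mathbb R^{n_{ej}}$ and $y_i,v_i,s_j,w_j\in\mathbb R^p$. Every edge $j$ joins two distinct nodes, its positive and its negative end; $h_{ij}=1$ if node $i$ is the positive end of edge $j$, $h_{ij}=-1$ if it is the negative end, and $h_{ij}=0$ otherwise; $H=(h_{ij})$. The coupling is $v_i=-\sum_j h_{ij}w_j$ and $s_j=\sum_i h_{ij}y_i$. The references of the neighboring inputs $v_i$ are $Q_v\nu_i$ with $\dot\nu_i=S_\eta\nu_i$, $\nu_i\in\mathbb R^q$. A pair $(G_1,G_2)$, where $G_2$ has $p$ columns, *incorporates a $p$-copy internal model of $S_\eta$* if $G_1=T\begin{bmatrix}S_1&S_2\\0&\mathrm{diag}(\alpha_1,\dots,\alpha_p)\end{bmatrix}T^{-1}$ and $G_2=T\begin{bmatrix}S_3\\\mathrm{diag}(\beta_1,\dots,\beta_p)\end{bmatrix}$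 with $T$ invertible, $S_1,S_2,S_3$ arbitrary, and, for every $i$, $\alpha_i$ a square matrix and $\beta_i$ a column such that $(\alpha_i,\beta_i)$ is controllable and the minimal polynomial of $S_\eta$ divides the characteristic polynomial of $\alpha_i$. **Controller.** For $\epsilon>0$ let $$\dot{\bar\eta}_i=G_S\bar\eta_i+\epsilon G_B(v_i-Q_v\nu_i),\qquad \dot\zeta_i=G_{1i}\zeta_i+G_{2i}(y_i-G_Q\bar\eta_i),\qquad u_i=K_{xi}x_i+K_{\zeta i}\zeta_i,$$ where every $(G_{1i},G_{2i})$ incorporates a $p$-copy internal model of $S_\eta$, and, for some $B_\eta\in\mathbb R^{q\times p}$ with columns $B_\eta^k$ and $Q_\eta\in\mathbb R^{p\times q}$ with rows $Q_\eta^k$, $$G_S=I_p\otimes S_\eta,\qquad G_B=\mathrm{diag}(B_\eta^1,\dots,B_\eta^p),\qquad G_Q=\mathrm{diag}(Q_\eta^1,\dots,Q_\eta^p).$$ The pair $(G_S,G_B)$ is controllable and incorporates a $p$-copy internal model of $S_\eta$, and there is a symmetric positive definite $P_\eta$ with $$(I_p\otimes P_\eta)G_S+G_S^T(I_p\otimes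 P_\eta)\le 0,\qquad (I_p\otimes P_\eta)G_B=G_Q^T .$$ **Assumptions.** A1) All $B_i,D_i,F_j$ have full column rank and all $C_i,G_j$ have full row rank. A2) All eigenvalues of $S_\eta$ lie on the imaginary axis and have algebraic multiplicity $1$. A3) Every edge $(E_j,F_j,G_j)$ is strictly positive real: there is a symmetric positive definite $Q_j$ with $Q_jE_j+E_j^TQ_j<0$ and $Q_jF_j=G_j^T$. A4) The network is connected: $\operatorname{rank}H=N-1$. A5) For every $i$, with $\hat A_i=\begin{bmatrix}A_i+B_iK_{xi}&B_iK_{\zeta i}\\G_{2i}C_i&G_{1i}\end{bmatrix}$, $\hat D_i=\begin{bmatrix}D_i\\0\end{bmatrix}$, $\hat C_i=\begin{bmatrix}C_i&0\end{bmatrix}$, the matrix $\hat A_i$ is Hurwitz and the system $\dot\xi=\hat A_i\xi+\hat D_iu$, $y=\hat C_i\xi$ is passive: it has a nonnegative quadratic storage function $V(\xi)=\tfrac12\xi^TP\xi$ with $\dot V\le u^Ty$ for every state $\xi$ and input $u$. A6) The reference trajectories satisfy $\sum_{i=1}^N\nu_i=0$. **Theorem (output cooperation).** Under A1)–A5) there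 is $\epsilon^*>0$ such that for all $0<\epsilon<\epsilon^*$ and for every trajectory on $[0,\infty)$ of the closed-loop system whose references satisfy A6), every neighboring input converges to its reference, $$v_i(t)-Q_v\nu_i(t)\to0\qquad(t\to\infty,\ i=1,\dots,N),$$ and the sum of the node outputs satisfies $$\sum_{i=1}^N y_i(t)-G_Qe^{G_St}\sum_{i=1}^N\bar\eta_i(0)\to0\qquad(t\to\infty).$$ -/

import Mathlib

open Matrix Filter Topology
open scoped Kronecker

/-- A real square matrix is Hurwitz when all its complex eigenvalues have negative real part. -/
def IsHurwitz {ι : Type*} [Fintype ι] [DecidableEq ι] (A : Matrix ι ι ℝ) : Prop :=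
  ∀ μ : ℂ, (A.map (algebraMap ℝ ℂ)).charpoly.IsRoot μ → μ.re < 0

/-- All complex eigenvalues lie on the imaginary axis and have algebraic multiplicity one. -/
def HasSimpleImaginarySpectrum {ι : Type*} [Fintype ι] [DecidableEq ι]
    (S : Matrix ι ι ℝ) : Prop :=
  ∀ μ : ℂ, (S.map (algebraMap ℝ ℂ)).charpoly.IsRoot μ →
    μ.re = 0 ∧ (S.map (algebraMap ℝ ℂ)).charpoly.rootMultiplicity μ = 1

/-- The Kalman controllability matrix `[B, A B, …, A ^ (n - 1) B]`. -/
def controllabilityMatrix {ι κ : Type*} [Fintype ι] [DecidableEq ι]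
    (A : Matrix ι ι ℝ) (B : Matrix ι κ ℝ) : Matrix ι (Fin (Fintype.card ι) × κ) ℝ :=
  Matrix.of fun a kb => (A ^ (kb.1 : ℕ) * B) a kb.2

/-- The pair `(A, B)` is controllable: the controllability matrix has full row rank. -/
def IsControllable {ι κ : Type*} [Fintype ι] [DecidableEq ι] [Fintype κ]
    (A : Matrix ι ι ℝ) (B : Matrix ι κ ℝ) : Prop :=
  (controllabilityMatrix A B).rank = Fintype.card ι

/-- Passivity of `ẋ = A x + B u`, `y = C x`: there is a nonnegative quadratic storage function
`V x = (1/2) xᵀ P x` whose derivative along the system satisfies `V̇ ≤ uᵀ y` for every state `x`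
and every input `u`. -/
def IsPassive {ι κ : Type*} [Fintype ι] [Fintype κ]
    (A : Matrix ι ι ℝ) (B : Matrix ι κ ℝ) (C : Matrix κ ι ℝ) : Prop :=
  ∃ P : Matrix ι ι ℝ, P.PosSemidef ∧
    ∀ (x : ι → ℝ) (u : κ → ℝ), x ⬝ᵥ (P *ᵥ (A *ᵥ x + B *ᵥ u)) ≤ u ⬝ᵥ (C *ᵥ x)

/-- Strict positive realness of the realization `ż = E z + F s`, `w = G z` (no feedthrough),
in its state-space form: `Q E + Eᵀ Q < 0` and `Q F = Gᵀ` for a positive definite `Q`. -/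
def IsStrictlyPositiveReal {ι κ : Type*} [Fintype ι]
    (E : Matrix ι ι ℝ) (F : Matrix ι κ ℝ) (G : Matrix κ ι ℝ) : Prop :=
  ∃ Q : Matrix ι ι ℝ, Q.PosDef ∧ (-(Q * E + Eᵀ * Q)).PosDef ∧ Q * F = Gᵀ

/-- `(G₁, G₂)` incorporates a `p`-copy internal model of `S`:
`G₁ = T [S₁, S₂; 0, diag(α₁, …, α_p)] T⁻¹` and `G₂ = T [S₃; diag(β₁, …, β_p)]` with every
`(αᵢ, βᵢ)` controllable and the minimal polynomial of `S` dividing the characteristic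
polynomial of every `αᵢ`. -/
def IncorporatesPCopy {ι : Type*} [Fintype ι] [DecidableEq ι] {p q : ℕ}
    (S : Matrix (Fin q) (Fin q) ℝ) (G₁ : Matrix ι ι ℝ) (G₂ : Matrix ι (Fin p) ℝ) : Prop :=
  ∃ (r : ℕ) (d : Fin p → ℕ)
    (α : ∀ i, Matrix (Fin (d i)) (Fin (d i)) ℝ) (β : ∀ i, Fin (d i) → ℝ)
    (S₁ : Matrix (Fin r) (Fin r) ℝ) (S₂ : Matrix (Fin r) (Σ i, Fin (d i)) ℝ)
    (S₃ : Matrix (Fin r) (Fin p) ℝ)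
    (T : Matrix ι (Fin r ⊕ Σ i, Fin (d i)) ℝ) (Tinv : Matrix (Fin r ⊕ Σ i, Fin (d i)) ι ℝ),
    T * Tinv = 1 ∧ Tinv * T = 1 ∧
    G₁ = T * Matrix.fromBlocks S₁ S₂ 0 (Matrix.blockDiagonal' α) * Tinv ∧
    G₂ = T * Matrix.fromRows S₃
      (Matrix.of fun (a : Σ i, Fin (d i)) (j : Fin p) => if a.1 = j then β a.1 a.2 else 0) ∧
    ∀ i, IsControllable (α i) (Matrix.replicateCol Unit (β i)) ∧
      minpoly ℝ S ∣ (α i).charpoly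

/-- The data of a multi-agent system with `N` dynamic nodes, `M` dynamic edges and
`p`-dimensional outputs: nodes `ẋᵢ = Aᵢ xᵢ + Bᵢ uᵢ + Dᵢ vᵢ`, `yᵢ = Cᵢ xᵢ`, edges
`żⱼ = Eⱼ zⱼ + Fⱼ sⱼ`, `wⱼ = Gⱼ zⱼ`, and the two (distinct) end nodes of every edge. -/
structure NetworkSystem (N M p : ℕ) where
  n : Fin N → ℕ
  m : Fin N → ℕ
  A : ∀ i, Matrix (Fin (n i)) (Fin (n i)) ℝ
  B : ∀ i, Matrix (Fin (n i)) (Fin (m i)) ℝ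
  C : ∀ i, Matrix (Fin p) (Fin (n i)) ℝ
  D : ∀ i, Matrix (Fin (n i)) (Fin p) ℝ
  ne : Fin M → ℕ
  E : ∀ j, Matrix (Fin (ne j)) (Fin (ne j)) ℝ
  F : ∀ j, Matrix (Fin (ne j)) (Fin p) ℝ
  G : ∀ j, Matrix (Fin p) (Fin (ne j)) ℝ
  posEnd : Fin M → Fin N
  negEnd : Fin M → Fin N
  ends_ne : ∀ j, posEnd j ≠ negEnd j

namespace NetworkSystem

variable {N M p : ℕ}

/-- The incidence matrix of the network. -/
def H (sys : NetworkSystem N M p) : Matrix (Fin N) (Fin M) ℝ :=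
  Matrix.of fun i j => if i = sys.posEnd j then 1 else if i = sys.negEnd j then -1 else 0

/-- The output `yᵢ = Cᵢ xᵢ` of node `i`. -/
def nodeOutput (sys : NetworkSystem N M p) (x : ∀ i, Fin (sys.n i) → ℝ) (i : Fin N) :
    Fin p → ℝ :=
  sys.C i *ᵥ x i

/-- The output `wⱼ = Gⱼ zⱼ` of edge `j`. -/
def edgeOutput (sys : NetworkSystem N M p) (z : ∀ j, Fin (sys.ne j) → ℝ) (j : Fin M) :
    Fin p → ℝ :=
  sys.G j *ᵥ z j

/-- The neighboring input `vᵢ = -∑ⱼ hᵢⱼ wⱼ` of node `i`. -/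
def neighboringInput (sys : NetworkSystem N M p) (z : ∀ j, Fin (sys.ne j) → ℝ) (i : Fin N) :
    Fin p → ℝ :=
  -∑ j, sys.H i j • sys.edgeOutput z j

/-- The input `sⱼ = ∑ᵢ hᵢⱼ yᵢ` of edge `j`. -/
def edgeInput (sys : NetworkSystem N M p) (x : ∀ i, Fin (sys.n i) → ℝ) (j : Fin M) :
    Fin p → ℝ :=
  ∑ i, sys.H i j • sys.nodeOutput x i

/-- Full column rank of all `Bᵢ`, `Dᵢ`, `Fⱼ` and full row rank of all `Cᵢ`, `Gⱼ`. -/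
def FullRank (sys : NetworkSystem N M p) : Prop :=
  (∀ i, (sys.B i).rank = sys.m i ∧ (sys.D i).rank = p ∧ (sys.C i).rank = p) ∧
    ∀ j, (sys.F j).rank = p ∧ (sys.G j).rank = p

/-- Connectedness of the network: the incidence matrix has rank `N - 1`. -/
def Connected (sys : NetworkSystem N M p) : Prop :=
  sys.H.rank + 1 = N

end NetworkSystem

/-- The matrices of the local controllers: internal model dynamics
`ζ̇ᵢ = G₁ᵢ ζᵢ + G₂ᵢ (tracking error)` and feedback `uᵢ = K_xᵢ xᵢ + K_ζᵢ ζᵢ`. -/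
structure LocalController {N M p : ℕ} (sys : NetworkSystem N M p) where
  c : Fin N → ℕ
  G₁ : ∀ i, Matrix (Fin (c i)) (Fin (c i)) ℝ
  G₂ : ∀ i, Matrix (Fin (c i)) (Fin p) ℝ
  Kx : ∀ i, Matrix (Fin (sys.m i)) (Fin (sys.n i)) ℝ
  Kζ : ∀ i, Matrix (Fin (sys.m i)) (Fin (c i)) ℝ

namespace LocalController

variable {N M p : ℕ} {sys : NetworkSystem N M p}

/-- `Âᵢ = [Aᵢ + Bᵢ K_xᵢ, Bᵢ K_ζᵢ; G₂ᵢ Cᵢ, G₁ᵢ]`. -/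
def hatA (ctrl : LocalController sys) (i : Fin N) :
    Matrix (Fin (sys.n i) ⊕ Fin (ctrl.c i)) (Fin (sys.n i) ⊕ Fin (ctrl.c i)) ℝ :=
  Matrix.fromBlocks (sys.A i + sys.B i * ctrl.Kx i) (sys.B i * ctrl.Kζ i)
    (ctrl.G₂ i * sys.C i) (ctrl.G₁ i)

/-- `D̂ᵢ = [Dᵢ; 0]`. -/
def hatD (ctrl : LocalController sys) (i : Fin N) :
    Matrix (Fin (sys.n i) ⊕ Fin (ctrl.c i)) (Fin p) ℝ :=
  Matrix.fromRows (sys.D i) 0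

/-- `Ĉᵢ = [Cᵢ, 0]`. -/
def hatC (ctrl : LocalController sys) (i : Fin N) :
    Matrix (Fin p) (Fin (sys.n i) ⊕ Fin (ctrl.c i)) ℝ :=
  Matrix.fromCols (sys.C i) 0

/-- The gains make `Âᵢ` Hurwitz and `(Âᵢ, D̂ᵢ, Ĉᵢ)` passive, for every node `i`. -/
def Passifies (ctrl : LocalController sys) : Prop :=
  ∀ i, IsHurwitz (ctrl.hatA i) ∧ IsPassive (ctrl.hatA i) (ctrl.hatD i) (ctrl.hatC i)

end LocalController

/-- `G_S = I_p ⊗ S_η`. -/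
def modelS (p : ℕ) {q : ℕ} (Sη : Matrix (Fin q) (Fin q) ℝ) :
    Matrix (Fin p × Fin q) (Fin p × Fin q) ℝ :=
  (1 : Matrix (Fin p) (Fin p) ℝ) ⊗ₖ Sη

/-- `G_B = diag(B_η^1, …, B_η^p)` with `B_η^i` the `i`-th column of `B_η`. -/
def modelB {p q : ℕ} (Bη : Matrix (Fin q) (Fin p) ℝ) : Matrix (Fin p × Fin q) (Fin p) ℝ :=
  Matrix.of fun a j => if a.1 = j then Bη a.2 j else 0

/-- `G_Q = diag(Q_η^1, …, Q_η^p)` with `Q_η^i` the `i`-th row of `Q_η`. -/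
def modelQ {p q : ℕ} (Qη : Matrix (Fin p) (Fin q) ℝ) : Matrix (Fin p) (Fin p × Fin q) ℝ :=
  Matrix.of fun j a => if j = a.1 then Qη j a.2 else 0

/-- `(x, z, η̄, ζ, ν)` is a trajectory on `[0, ∞)` of the network in closed loop with
`η̄̇ᵢ = G_S η̄ᵢ + ε G_B (vᵢ - Q_v νᵢ)`, `ζ̇ᵢ = G₁ᵢ ζᵢ + G₂ᵢ (yᵢ - G_Q η̄ᵢ)`,
`uᵢ = K_xᵢ xᵢ + K_ζᵢ ζᵢ`, where the references are generated by `ν̇ᵢ = S_η νᵢ`. -/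
structure IsClosedLoopTrajectory {N M p q : ℕ} (sys : NetworkSystem N M p)
    (ctrl : LocalController sys) (Sη : Matrix (Fin q) (Fin q) ℝ)
    (Bη : Matrix (Fin q) (Fin p) ℝ) (Qη Qv : Matrix (Fin p) (Fin q) ℝ) (ε : ℝ)
    (x : ℝ → ∀ i, Fin (sys.n i) → ℝ) (z : ℝ → ∀ j, Fin (sys.ne j) → ℝ)
    (ηbar : ℝ → Fin N → Fin p × Fin q → ℝ) (ζ : ℝ → ∀ i, Fin (ctrl.c i) → ℝ)
    (ν : ℝ → Fin N → Fin q → ℝ) : Prop where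
  node : ∀ i, ∀ t ≥ 0, HasDerivWithinAt (fun τ => x τ i)
    (sys.A i *ᵥ x t i + sys.B i *ᵥ (ctrl.Kx i *ᵥ x t i + ctrl.Kζ i *ᵥ ζ t i)
      + sys.D i *ᵥ sys.neighboringInput (z t) i) (Set.Ici 0) t
  edge : ∀ j, ∀ t ≥ 0, HasDerivWithinAt (fun τ => z τ j)
    (sys.E j *ᵥ z t j + sys.F j *ᵥ sys.edgeInput (x t) j) (Set.Ici 0) t
  outputReference : ∀ i, ∀ t ≥ 0, HasDerivWithinAt (fun τ => ηbar τ i)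
    (modelS p Sη *ᵥ ηbar t i
      + ε • (modelB Bη *ᵥ (sys.neighboringInput (z t) i - Qv *ᵥ ν t i))) (Set.Ici 0) t
  internalModel : ∀ i, ∀ t ≥ 0, HasDerivWithinAt (fun τ => ζ τ i)
    (ctrl.G₁ i *ᵥ ζ t i
      + ctrl.G₂ i *ᵥ (sys.nodeOutput (x t) i - modelQ Qη *ᵥ ηbar t i)) (Set.Ici 0) t
  inputReference : ∀ i, ∀ t ≥ 0, HasDerivWithinAt (fun τ => ν τ i)
    (Sη *ᵥ ν t i) (Set.Ici 0) t

/-! ### Matrix equations, internal models and weighted traces. -/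

section Algebra

open Polynomial

variable {ι κ : Type*} [Fintype ι] [DecidableEq ι] [Fintype κ] [DecidableEq κ]

/-! The closed loop is linear, so it suffices to find one trajectory with the given references that
tracks exactly, and to show that the difference of two trajectories with equal references, which is
a trajectory with zero references, settles.

Settling (`NetworkSystem.eventually_tendsto_zero`): the regulator equations (`exists_regulator`)
remove from each node the steady state imposed by `ηbar`; what remains is a passive Hurwitz node,
perturbed by a term of order `ε` in its input. Nodes, edges and the reference models, the latter
weighted by `ε⁻¹`, have storage functions whose supply rates cancel through the incidence matrix.
For small `ε` the strict dissipation of the edges dominates the perturbation, and a Barbalat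
argument sends node and edge states to zero.

Exact tracking (`exists_reference_trajectory`): every signal is sought as a constant matrix applied
to the `ν k`. Prescribing the neighboring inputs gives a square linear system for the edge states
and node outputs (`NetworkSystem.exists_edge_steadyState`). Its injectivity is a dissipation
argument under the weight `Pη⁻¹`; it works because the imaginary spectrum has zero trace, which
turns the Lyapunov inequality into an equality. The required outputs are then produced by the
reference models (`exists_model_realization`) and by the nodes (`exists_regulator`).

For the sum of the outputs, the driving terms of the `ηbar i` add up to zero, so their sum evolves
freely by the matrix exponential. -/

theorem Matrix.mul_aeval_of_intertwine {X : Matrix ι κ ℝ} {A : Matrix ι ι ℝ} {S : Matrix κ κ ℝ}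
    (h : X * S = A * X) (f : ℝ[X]) : X * aeval S f = aeval A f * X := by
  induction f using Polynomial.induction_on' with
  | add f g hf hg => simp only [map_add, Matrix.mul_add, Matrix.add_mul, hf, hg]
  | monomial n a =>
    have hp : X * S ^ n = A ^ n * X := by
      induction n with
      | zero => simp
      | succ n ih => rw [pow_succ, ← Matrix.mul_assoc, ih, Matrix.mul_assoc, h, pow_succ,
          Matrix.mul_assoc]
    simp only [aeval_monomial, Algebra.algebraMap_eq_smul_one, smul_one_mul, Matrix.mul_smul,
      Matrix.smul_mul, hp]

/-- The Sylvester equation `X S - A X = R` is solvable when a polynomial annihilates `A` and is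
invertible at `S`. -/
theorem Matrix.exists_mul_sub_mul_eq {A : Matrix ι ι ℝ} {S : Matrix κ κ ℝ} {f : ℝ[X]}
    (hA : aeval A f = 0) (hS : IsUnit (aeval S f)) (R : Matrix ι κ ℝ) :
    ∃ X : Matrix ι κ ℝ, X * S - A * X = R := by
  let T : Matrix ι κ ℝ →ₗ[ℝ] Matrix ι κ ℝ :=
    { toFun := fun X => X * S - A * X
      map_add' := fun X Y => by simp only [Matrix.add_mul, Matrix.mul_add]; abel
      map_smul' := fun c X => by simp [smul_sub] }
  -- A kernel element intertwines `S` and `A`, so `X f(S) = f(A) X = 0` with `f(S)` invertible.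
  -- Surjectivity follows by finite dimension.
  have hinj : Function.Injective T := by
    rw [← LinearMap.ker_eq_bot, LinearMap.ker_eq_bot']
    intro X hX
    have h := mul_aeval_of_intertwine (sub_eq_zero.1 hX : X * S = A * X) f
    rw [hA, Matrix.zero_mul] at h
    obtain ⟨u, hu⟩ := hS
    calc X = X * (aeval S f * ((u⁻¹ : (Matrix κ κ ℝ)ˣ) : Matrix κ κ ℝ)) := by
          rw [← hu, Units.mul_inv, Matrix.mul_one]
      _ = 0 := by rw [← Matrix.mul_assoc, h, Matrix.zero_mul]
  exact LinearMap.injective_iff_surjective.1 hinj R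

theorem Matrix.exists_mul_eq_one_of_rank_eq {A : Matrix ι κ ℝ} (h : A.rank = Fintype.card ι) :
    ∃ B : Matrix κ ι ℝ, A * B = 1 := by
  rw [← mulVec_surjective_iff_exists_right_inverse]
  have : LinearMap.range A.mulVecLin = ⊤ := by
    apply Submodule.eq_top_of_finrank_eq
    rw [Module.finrank_fintype_fun_eq_card]
    exact h
  exact LinearMap.range_eq_top.1 this

theorem Matrix.mul_left_eq_zero_of_rank_eq {μ : Type*} {A : Matrix ι κ ℝ}
    (h : A.rank = Fintype.card κ) {X : Matrix κ μ ℝ} (hX : A * X = 0) : X = 0 := by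
  obtain ⟨B, hB⟩ := exists_mul_eq_one_of_rank_eq (A := Aᵀ) (by rw [rank_transpose, h])
  have hB' : Bᵀ * A = 1 := by rw [← transpose_inj]; simpa using hB
  calc X = Bᵀ * A * X := by rw [hB', Matrix.one_mul]
    _ = 0 := by rw [Matrix.mul_assoc, hX, Matrix.mul_zero]

/-- With a single input the controllability matrix is square, and `w` is the last row of its
inverse. -/
theorem exists_dual_of_isControllable {d : ℕ} {α : Matrix (Fin (d + 1)) (Fin (d + 1)) ℝ}
    {β : Fin (d + 1) → ℝ} (h : IsControllable α (replicateCol Unit β)) :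
    ∃ w : Fin (d + 1) → ℝ, (∀ a < d, w ⬝ᵥ ((α ^ a) *ᵥ β) = 0) ∧ w ⬝ᵥ ((α ^ d) *ᵥ β) = 1 := by
  set C := controllabilityMatrix α (replicateCol Unit β) with hC
  obtain ⟨D, hD⟩ := exists_mul_eq_one_of_rank_eq (A := C) h
  have hD' : D * C = 1 := (mul_eq_one_comm_of_card_eq _ _ _ (by simp)).1 hD
  have hcard : Fintype.card (Fin (d + 1)) = d + 1 := Fintype.card_fin _
  have key : ∀ a : ℕ, ∀ ha : a < Fintype.card (Fin (d + 1)), ∀ w : Fin (d + 1) → ℝ,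
      (w ᵥ* C) (⟨a, ha⟩, ()) = w ⬝ᵥ ((α ^ a) *ᵥ β) := by
    intro a ha w
    simp only [vecMul, hC, controllabilityMatrix, dotProduct, Matrix.of_apply, mul_apply,
      replicateCol_apply, mulVec]
  refine ⟨Pi.single (⟨d, by omega⟩, ()) 1 ᵥ* D, fun a ha => ?_, ?_⟩
  · rw [← key a (by omega), vecMul_vecMul, hD', vecMul_one, Pi.single_apply, if_neg]
    simp only [Prod.mk.injEq, Fin.mk.injEq]
    omega
  · rw [← key d (by omega), vecMul_vecMul, hD', vecMul_one, Pi.single_eq_same]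

/-- A controllable single-input copy whose characteristic polynomial annihilates `S` cannot be
driven in the mode of `S` by a nonzero error. -/
theorem eq_zero_of_isControllable {d : ℕ} {α : Matrix (Fin d) (Fin d) ℝ} {β : Fin d → ℝ}
    (h : IsControllable α (replicateCol Unit β)) {S : Matrix κ κ ℝ} (hS : aeval S α.charpoly = 0)
    {Z : Matrix (Fin d) κ ℝ} {e : κ → ℝ} (hZ : Z * S = α * Z + vecMulVec β e) : e = 0 := by
  rcases d with _ | d
  -- In dimension zero the characteristic polynomial is `1`, so the annihilation hypothesis makes
  -- the whole matrix ring over `κ` trivial.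
  · have h1 : (1 : Matrix κ κ ℝ) = 0 := by
      have : α.charpoly = 1 := by simp [Matrix.charpoly]
      simpa [this] using hS
    rw [← vecMul_one e, h1, vecMul_zero]
  obtain ⟨w, hw0, hw1⟩ := exists_dual_of_isControllable h
  have step : ∀ a : ℕ, w ᵥ* (α ^ a * Z * S)
      = w ᵥ* (α ^ (a + 1) * Z) + (w ⬝ᵥ ((α ^ a) *ᵥ β)) • e := by
    intro a
    rw [Matrix.mul_assoc, hZ, Matrix.mul_add, vecMul_add, ← Matrix.mul_assoc, ← pow_succ,
      mul_vecMulVec, vecMul_vecMulVec]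
  -- Seen through `w`, the error `e` stays invisible up to power `d` and enters at power `d + 1`
  -- with coefficient one. As the characteristic polynomial is monic of degree `d + 1` and
  -- annihilates both `α` and `S`, comparing the two evaluations leaves `e` alone.
  have hlow : ∀ a ≤ d, w ᵥ* (α ^ a * Z) = w ᵥ* (Z * S ^ a) := by
    intro a
    induction a with
    | zero => simp
    | succ a ih =>
      intro ha
      have h1 := step a
      rw [hw0 a (by omega), zero_smul, add_zero] at h1
      rw [← h1, ← vecMul_vecMul, ih (by omega), vecMul_vecMul, pow_succ, Matrix.mul_assoc]
  have htop : w ᵥ* (Z * S ^ (d + 1)) = w ᵥ* (α ^ (d + 1) * Z) + e := by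
    have h1 := step d
    rw [hw1, one_smul, ← vecMul_vecMul, hlow d le_rfl, vecMul_vecMul, Matrix.mul_assoc,
      ← pow_succ] at h1
    exact h1
  have hdeg : α.charpoly.natDegree = d + 1 := by simp
  have hlead : α.charpoly.coeff (d + 1) = 1 := by
    have := α.charpoly_monic.coeff_natDegree
    rwa [hdeg] at this
  have hα : w ᵥ* (aeval α α.charpoly * Z) = 0 := by rw [aeval_self_charpoly]; simp
  have hS' : w ᵥ* (Z * aeval S α.charpoly) = 0 := by rw [hS]; simp
  rw [aeval_eq_sum_range, hdeg, Finset.sum_range_succ, hlead, one_smul] at hα hS'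
  rw [Matrix.mul_add, vecMul_add, htop, Matrix.mul_sum] at hS'
  rw [Matrix.add_mul, vecMul_add, Matrix.sum_mul] at hα
  have heq : w ᵥ* (∑ i ∈ Finset.range (d + 1), (α.charpoly.coeff i • α ^ i) * Z)
      = w ᵥ* (∑ i ∈ Finset.range (d + 1), Z * (α.charpoly.coeff i • S ^ i)) := by
    simp only [vecMul_sum, Matrix.smul_mul, Matrix.mul_smul, vecMul_smul]
    refine Finset.sum_congr rfl fun i hi => ?_
    rw [hlow i (by simpa [Nat.lt_succ_iff] using hi)]
  rw [← heq, ← add_assoc, hα, zero_add] at hS'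
  exact hS'

/-- In the coordinates `T` the lower block does not see the upper one, and its `k`-th copy is driven
by the `k`-th row of `e` only. The single-input result thus applies row by row. -/
theorem IncorporatesPCopy.eq_zero {p q : ℕ} {Sη : Matrix (Fin q) (Fin q) ℝ}
    {G₁ : Matrix ι ι ℝ} {G₂ : Matrix ι (Fin p) ℝ} (h : IncorporatesPCopy Sη G₁ G₂)
    {S : Matrix κ κ ℝ} (hS : aeval S (minpoly ℝ Sη) = 0) {Z : Matrix ι κ ℝ}
    {e : Matrix (Fin p) κ ℝ} (hZ : Z * S = G₁ * Z + G₂ * e) : e = 0 := by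
  obtain ⟨r, d, α, β, S₁, S₂, S₃, T, Tinv, hT, hT', rfl, rfl, hαβ⟩ := h
  have hZ' : Tinv * Z * S = fromBlocks S₁ S₂ 0 (blockDiagonal' α) * (Tinv * Z)
      + fromRows S₃ (Matrix.of fun (a : Σ i, Fin (d i)) (j : Fin p) =>
        if a.1 = j then β a.1 a.2 else 0) * e := by
    rw [Matrix.mul_assoc, hZ, Matrix.mul_add]
    congr 1
    · rw [← Matrix.mul_assoc, ← Matrix.mul_assoc, ← Matrix.mul_assoc, hT', Matrix.one_mul,
        Matrix.mul_assoc]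
    · rw [← Matrix.mul_assoc, ← Matrix.mul_assoc, hT', Matrix.one_mul]
  ext k b
  have hk : e k = 0 := by
    refine eq_zero_of_isControllable (hαβ k).1 (S := S)
      (Z := Matrix.of fun a b => (Tinv * Z) (Sum.inr ⟨k, a⟩) b) ?_ ?_
    · obtain ⟨g, hg⟩ := (hαβ k).2
      rw [hg, map_mul, hS, zero_mul]
    · ext a b
      have := congrFun (congrFun hZ' (Sum.inr ⟨k, a⟩)) b
      simp only [Matrix.add_apply, mul_apply (M := fromBlocks _ _ _ _),
        mul_apply (M := fromRows _ _), Fintype.sum_sum_type, fromBlocks_apply₂₁,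
        fromBlocks_apply₂₂, fromRows_apply_inr, Matrix.zero_apply, zero_mul,
        Finset.sum_const_zero, zero_add, Matrix.of_apply, ite_mul, Finset.sum_ite_eq,
        Finset.mem_univ, if_true] at this
      rw [Matrix.add_apply, vecMulVec_apply, mul_apply, mul_apply]
      simp only [Matrix.of_apply]
      rw [mul_apply] at this
      rw [this]
      congr 1
      rw [Fintype.sum_sigma, Finset.sum_eq_single k]
      · simp [blockDiagonal'_apply_eq]
      · intro k' _ hk'
        exact Finset.sum_eq_zero fun a' _ => by rw [blockDiagonal'_apply_ne _ _ _ hk'.symm, zero_mul]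
      · simp
  rw [hk]; rfl

/-- Solvability of the regulator equations for a Hurwitz interconnection with an internal model. -/
theorem exists_regulator {n c p q m : ℕ} {Sη : Matrix (Fin q) (Fin q) ℝ}
    {A : Matrix (Fin n) (Fin n) ℝ} {B : Matrix (Fin n) (Fin m) ℝ} {C : Matrix (Fin p) (Fin n) ℝ}
    {Kx : Matrix (Fin m) (Fin n) ℝ} {Kζ : Matrix (Fin m) (Fin c) ℝ}
    {G₁ : Matrix (Fin c) (Fin c) ℝ} {G₂ : Matrix (Fin c) (Fin p) ℝ}
    (h : IncorporatesPCopy Sη G₁ G₂) {f : ℝ[X]} {S : Matrix κ κ ℝ}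
    (hf : aeval (fromBlocks (A + B * Kx) (B * Kζ) (G₂ * C) G₁) f = 0)
    (hcop : IsCoprime f (minpoly ℝ Sη)) (hS : aeval S (minpoly ℝ Sη) = 0)
    (R : Matrix (Fin n) κ ℝ) (Y : Matrix (Fin p) κ ℝ) :
    ∃ (X : Matrix (Fin n) κ ℝ) (Z : Matrix (Fin c) κ ℝ),
      X * S = A * X + B * (Kx * X + Kζ * Z) + R ∧ Z * S = G₁ * Z ∧ C * X = Y := by
  have hu : IsUnit (aeval S f) := by
    obtain ⟨a, b, hab⟩ := hcop
    have := congrArg (aeval S) hab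
    rw [map_add, map_mul, map_mul, hS, mul_zero, add_zero, map_one] at this
    exact IsUnit.of_mul_eq_one_right _ this
  -- With this right-hand side the lower block reads `Z S = G₁ Z + G₂ (C X - Y)`, so the internal
  -- model forces `C X = Y`.
  obtain ⟨W, hW⟩ := exists_mul_sub_mul_eq hf hu (fromRows R (-(G₂ * Y)))
  have hadd : ∀ (a b : Matrix (Fin n) κ ℝ) (a' b' : Matrix (Fin c) κ ℝ),
      fromRows a a' + fromRows b b' = fromRows (a + b) (a' + b') := by
    intro a b a' b'
    ext (i | i) j <;> rfl
  rw [sub_eq_iff_eq_add, ← fromRows_toRows W, fromRows_mul, fromBlocks_mul_fromRows, hadd,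
    fromRows_ext_iff] at hW
  obtain ⟨h1, h2⟩ := hW
  have he : C * W.toRows₁ - Y = 0 := by
    refine h.eq_zero hS (Z := W.toRows₂) ?_
    rw [h2, Matrix.mul_sub, Matrix.mul_assoc]
    abel
  refine ⟨W.toRows₁, W.toRows₂, ?_, ?_, sub_eq_zero.1 he⟩
  · rw [h1, Matrix.add_mul, Matrix.mul_add, Matrix.mul_assoc, Matrix.mul_assoc]
    abel
  · rw [h2, Matrix.mul_assoc, sub_eq_zero.1 he]
    abel

/-- A common complex root would have both negative and zero real part. -/
theorem isCoprime_charpoly_minpoly {A : Matrix ι ι ℝ} (hA : IsHurwitz A) {S : Matrix κ κ ℝ}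
    (hS : HasSimpleImaginarySpectrum S) : IsCoprime A.charpoly (minpoly ℝ S) := by
  refine (isCoprime_iff_aeval_ne_zero_of_isAlgClosed ℝ ℂ _ _).2 fun a => ?_
  by_contra! hcon
  have key : ∀ {o : Type _} [Fintype o] [DecidableEq o] (N : Matrix o o ℝ),
      aeval a N.charpoly = 0 → (N.map (algebraMap ℝ ℂ)).charpoly.IsRoot a := by
    intro o _ _ N hN
    rw [IsRoot.def, charpoly_map, eval_map_algebraMap, hN]
  have h1 := hA a (key A hcon.1)
  have h2 : aeval a S.charpoly = 0 := by
    obtain ⟨g, hg⟩ := S.minpoly_dvd_charpoly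
    rw [hg, map_mul, hcon.2, zero_mul]
  have h3 : (S.map (algebraMap ℝ ℂ)).charpoly.IsRoot a := by
    rw [IsRoot.def, charpoly_map, eval_map_algebraMap, h2]
  have := (hS a h3).1
  linarith

/-- The trace is real and is the sum of the complex roots, all of which have zero real part. -/
theorem HasSimpleImaginarySpectrum.trace_eq_zero {S : Matrix κ κ ℝ}
    (hS : HasSimpleImaginarySpectrum S) : S.trace = 0 := by
  have h1 : ((S.trace : ℝ) : ℂ) = (S.map (algebraMap ℝ ℂ)).charpoly.roots.sum := by
    rw [← trace_eq_sum_roots_charpoly]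
    simp [Matrix.trace]
  have h2 := congrArg Complex.reCLM h1
  rw [map_multiset_sum] at h2
  simp only [Complex.reCLM_apply, Complex.ofReal_re] at h2
  rw [h2]
  refine Multiset.sum_eq_zero fun x hx => ?_
  obtain ⟨μ, hμ, rfl⟩ := Multiset.mem_map.1 hx
  exact (hS μ (isRoot_of_mem_roots hμ)).1

theorem aeval_one_kronecker {o : Type*} [Fintype o] [DecidableEq o] (S : Matrix κ κ ℝ)
    (f : ℝ[X]) : aeval ((1 : Matrix o o ℝ) ⊗ₖ S) f = (1 : Matrix o o ℝ) ⊗ₖ aeval S f := by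
  induction f using Polynomial.induction_on' with
  | add f g hf hg => simp only [map_add, hf, hg, kronecker_add]
  | monomial n a =>
    have hp : ((1 : Matrix o o ℝ) ⊗ₖ S) ^ n = (1 : Matrix o o ℝ) ⊗ₖ (S ^ n) := by
      induction n with
      | zero => simp
      | succ n ih => rw [pow_succ, ih, ← mul_kronecker_mul, Matrix.one_mul, pow_succ]
    simp only [aeval_monomial, Algebra.algebraMap_eq_smul_one, smul_one_mul, hp, kronecker_smul]

theorem Matrix.PosDef.exists_isUnit_transpose_mul {R : Matrix ι ι ℝ} (hR : R.PosDef) :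
    ∃ K : Matrix ι ι ℝ, IsUnit K ∧ R = Kᵀ * K := by
  open scoped MatrixOrder in
  obtain ⟨K, hK⟩ := CStarAlgebra.nonneg_iff_eq_star_mul_self.1 hR.posSemidef.nonneg
  have hK' : R = Kᵀ * K := hK
  refine ⟨K, ?_, hK'⟩
  have := hR.isUnit
  rw [hK', isUnit_iff_isUnit_det, det_mul] at this
  exact (isUnit_iff_isUnit_det K).2 (isUnit_of_mul_isUnit_right this)

/-- Writing `R = Kᵀ K`, the trace is that of the positive semidefinite matrix `K (Z M Zᵀ) Kᵀ`, which
vanishes when its trace does, and `K` can be cancelled. -/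
theorem Matrix.trace_mul_mul_mul_transpose {R : Matrix ι ι ℝ} (hR : R.PosDef) {M : Matrix κ κ ℝ}
    (hM : M.PosSemidef) (Z : Matrix ι κ ℝ) :
    0 ≤ (R * Z * M * Zᵀ).trace ∧ ((R * Z * M * Zᵀ).trace = 0 → Z * M * Zᵀ = 0) := by
  obtain ⟨K, hK, rfl⟩ := hR.exists_isUnit_transpose_mul
  have h1 : (Kᵀ * K * Z * M * Zᵀ).trace = (K * (Z * M * Zᵀ) * Kᵀ).trace := by
    rw [Matrix.trace_mul_comm _ Kᵀ]
    simp only [Matrix.mul_assoc]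
  have h2 : (K * (Z * M * Zᵀ) * Kᵀ).PosSemidef :=
    (hM.mul_mul_conjTranspose_same Z).mul_mul_conjTranspose_same K
  rw [h1]
  refine ⟨h2.trace_nonneg, fun h => ?_⟩
  have h3 := h2.trace_eq_zero_iff.1 h
  have hKt : IsUnit Kᵀ := by rwa [isUnit_transpose]
  rw [hKt.mul_left_eq_zero, hK.mul_right_eq_zero] at h3
  exact h3

theorem Matrix.PosDef.eq_zero_of_mul_mul_transpose {M : Matrix κ κ ℝ} (hM : M.PosDef)
    {Z : Matrix ι κ ℝ} (h : Z * M * Zᵀ = 0) : Z = 0 := by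
  obtain ⟨K, hK, rfl⟩ := hM.exists_isUnit_transpose_mul
  have h1 : (Z * Kᵀ) * (Z * Kᵀ)ᴴ = 0 := by
    rw [conjTranspose_eq_transpose_of_trivial, transpose_mul, transpose_transpose, ← h]
    simp only [Matrix.mul_assoc]
  rw [self_mul_conjTranspose_eq_zero] at h1
  obtain ⟨u, hu⟩ := (isUnit_transpose K).2 hK
  calc Z = Z * (Kᵀ * (↑u⁻¹ : Matrix κ κ ℝ)) := by rw [← hu, Units.mul_inv, Matrix.mul_one]
    _ = 0 := by rw [← Matrix.mul_assoc, h1, Matrix.zero_mul]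

/-- A Lyapunov inequality for a matrix of zero trace is an equality. -/
theorem Matrix.PosDef.add_transpose_mul_eq_zero {P S : Matrix κ κ ℝ} (hP : P.PosDef)
    (hS : S.trace = 0) (h : (-(P * S + Sᵀ * P)).PosSemidef) : P * S + Sᵀ * P = 0 := by
  have hdet : IsUnit P.det := (isUnit_iff_isUnit_det P).1 hP.isUnit
  -- Weighted by `P⁻¹`, the semidefinite matrix has trace `-2 tr S = 0`.
  have h1 := (trace_mul_mul_mul_transpose hP.inv h 1).2 (by
    rw [transpose_one, Matrix.mul_one, Matrix.mul_one, Matrix.mul_neg, trace_neg, Matrix.mul_add,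
      trace_add, ← Matrix.mul_assoc, nonsing_inv_mul _ hdet, Matrix.one_mul, hS,
      ← Matrix.mul_assoc, trace_mul_comm, ← Matrix.mul_assoc, mul_nonsing_inv _ hdet,
      Matrix.one_mul, trace_transpose, hS]
    simp)
  rwa [Matrix.one_mul, transpose_one, Matrix.mul_one, neg_eq_zero] at h1

end Algebra

/-! ### The `p`-copy reference model. -/

section Model

variable {p q : ℕ}

theorem modelS_mul_apply {o : Type*} (S : Matrix (Fin q) (Fin q) ℝ)
    (X : Matrix (Fin p × Fin q) o ℝ) (k : Fin p) (b : Fin q) (j : o) :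
    (modelS p S * X) (k, b) j = ∑ b', S b b' * X (k, b') j := by
  simp [modelS, mul_apply, Fintype.sum_prod_type, kroneckerMap_apply, one_apply, ite_mul]

theorem modelQ_mul_apply {o : Type*} (Q : Matrix (Fin p) (Fin q) ℝ)
    (X : Matrix (Fin p × Fin q) o ℝ) (k : Fin p) (j : o) :
    (modelQ Q * X) k j = ∑ b, Q k b * X (k, b) j := by
  simp [modelQ, mul_apply, Fintype.sum_prod_type, ite_mul]

/-- One diagonal block of the Kronecker inequality is the inequality for `P` and `S`; zero trace
makes it an equality. Positivity of `p` provides the block. -/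
theorem lyapunov_equality_of_model {P S : Matrix (Fin q) (Fin q) ℝ} (hp : 0 < p) (hP : P.PosDef)
    (hS : HasSimpleImaginarySpectrum S)
    (h : (-(((1 : Matrix (Fin p) (Fin p) ℝ) ⊗ₖ P) * modelS p S
      + (modelS p S)ᵀ * ((1 : Matrix (Fin p) (Fin p) ℝ) ⊗ₖ P))).PosSemidef) :
    P * S + Sᵀ * P = 0 := by
  refine hP.add_transpose_mul_eq_zero hS.trace_eq_zero ?_
  have h1 := h.submatrix (fun b : Fin q => ((⟨0, hp⟩ : Fin p), b))
  convert h1 using 1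
  ext a b
  rw [modelS, ← kroneckerMap_transpose, transpose_one, ← mul_kronecker_mul, ← mul_kronecker_mul]
  simp [kroneckerMap_apply]

theorem posDef_one_kronecker {P : Matrix (Fin q) (Fin q) ℝ} (hP : P.PosDef) :
    ((1 : Matrix (Fin p) (Fin p) ℝ) ⊗ₖ P).PosDef :=
  PosDef.one.kronecker hP

/-- Reach the vector that carries `y` in block `k`: only the `k`-th input acts on that block, so its
coefficients define a polynomial in `S` sending the `k`-th column of `B` to `y`. Being a polynomial
in `S`, it commutes with `S`. -/
theorem exists_commute_mulVec_eq {S : Matrix (Fin q) (Fin q) ℝ} {B : Matrix (Fin q) (Fin p) ℝ}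
    (h : IsControllable (modelS p S) (modelB B)) (k : Fin p) (y : Fin q → ℝ) :
    ∃ L : Matrix (Fin q) (Fin q) ℝ, L * S = S * L ∧ L *ᵥ B.col k = y := by
  obtain ⟨D, hD⟩ := exists_mul_eq_one_of_rank_eq h
  set v : Fin p × Fin q → ℝ := fun a => if a.1 = k then y a.2 else 0 with hv
  set c := D *ᵥ v with hc
  have hCc : controllabilityMatrix (modelS p S) (modelB B) *ᵥ c = v := by
    rw [hc, mulVec_mulVec, hD, one_mulVec]
  have hpow : ∀ n : ℕ, modelS p S ^ n = modelS p (S ^ n) := by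
    intro n
    induction n with
    | zero => simp [modelS]
    | succ n ih => rw [pow_succ, ih, modelS, modelS, modelS, ← mul_kronecker_mul, Matrix.one_mul,
        pow_succ]
  refine ⟨∑ a : Fin (Fintype.card (Fin p × Fin q)), c (a, k) • S ^ (a : ℕ), ?_, ?_⟩
  · rw [Matrix.sum_mul, Matrix.mul_sum]
    refine Finset.sum_congr rfl fun a _ => ?_
    rw [Matrix.smul_mul, Matrix.mul_smul, ← pow_succ, ← pow_succ']
  · ext b
    have h1 := congrFun hCc (k, b)
    simp only [hv, if_true] at h1
    rw [← h1, sum_mulVec, Finset.sum_apply, mulVec, dotProduct, Fintype.sum_prod_type]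
    refine Finset.sum_congr rfl fun a _ => ?_
    simp only [controllabilityMatrix, Matrix.of_apply, hpow, modelS_mul_apply, modelB]
    rw [Finset.sum_eq_single k]
    · simp only [if_true, Matrix.smul_apply, smul_eq_mul, mulVec, dotProduct, col_apply,
        Finset.sum_mul]
      exact Finset.sum_congr rfl fun x _ => by ring
    · intro j _ hj
      simp [hj.symm]
    · simp

/-- Every output of a linear function of the modes of `S` is an output of the `p`-copy model. -/
theorem exists_model_realization {P S : Matrix (Fin q) (Fin q) ℝ} {B : Matrix (Fin q) (Fin p) ℝ}
    {Q : Matrix (Fin p) (Fin q) ℝ} (hP : P.PosDef) (hPS : P * S + Sᵀ * P = 0)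
    (h : IsControllable (modelS p S) (modelB B))
    (hGB : ((1 : Matrix (Fin p) (Fin p) ℝ) ⊗ₖ P) * modelB B = (modelQ Q)ᵀ)
    (Y : Matrix (Fin p) (Fin q) ℝ) :
    ∃ X : Matrix (Fin p × Fin q) (Fin q) ℝ, modelS p S * X = X * S ∧ modelQ Q * X = Y := by
  have hdet : IsUnit P.det := (isUnit_iff_isUnit_det P).1 hP.isUnit
  have hsymm : Pᵀ = P := hP.isHermitian
  -- Block `k` of the solution is `P⁻¹ Lₖᵀ P`. It commutes with `S` because `P` conjugates `S` to
  -- `-Sᵀ`, and since `Qₖ = Bₖᵀ P`, its output is `(Lₖ Bₖ)ᵀ P`, equal to `Yₖ` by this choice of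
  -- target.
  choose L hL hLB using fun k => exists_commute_mulVec_eq h k (Y.row k ᵥ* P⁻¹)
  have hPS' : P * S = -(Sᵀ * P) := eq_neg_of_add_eq_zero_left hPS
  have hSP : S * P⁻¹ = -(P⁻¹ * Sᵀ) := by
    have : P⁻¹ * (P * S) * P⁻¹ = P⁻¹ * (-(Sᵀ * P)) * P⁻¹ := by rw [hPS']
    rwa [← Matrix.mul_assoc, nonsing_inv_mul _ hdet, Matrix.one_mul, Matrix.mul_neg,
      Matrix.neg_mul, ← Matrix.mul_assoc, Matrix.mul_assoc _ P, mul_nonsing_inv _ hdet,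
      Matrix.mul_one] at this
  have hcomm : ∀ k, S * (P⁻¹ * (L k)ᵀ * P) = P⁻¹ * (L k)ᵀ * P * S := by
    intro k
    have h2 : Sᵀ * (L k)ᵀ = (L k)ᵀ * Sᵀ := by rw [← transpose_mul, ← transpose_mul, hL]
    rw [Matrix.mul_assoc _ P, hPS', ← Matrix.mul_assoc, ← Matrix.mul_assoc, hSP, Matrix.neg_mul,
      Matrix.mul_assoc _ Sᵀ, h2, Matrix.mul_neg, Matrix.neg_mul]
    simp only [Matrix.mul_assoc]
  have hQ : ∀ k, Q.row k = B.col k ᵥ* P := by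
    intro k
    ext b
    have h3 := congrFun (congrFun hGB (k, b)) k
    have h4 := modelS_mul_apply P (modelB B) k b k
    rw [modelS] at h4
    rw [h4] at h3
    simp only [modelB, modelQ, Matrix.of_apply, if_true, transpose_apply] at h3
    rw [row_apply, ← h3, vecMul, dotProduct]
    refine Finset.sum_congr rfl fun b' _ => ?_
    rw [col_apply, mul_comm, ← transpose_apply P, hsymm]
  refine ⟨Matrix.of fun a j => (P⁻¹ * (L a.1)ᵀ * P) a.2 j, ?_, ?_⟩
  · ext ⟨k, b⟩ j
    rw [modelS_mul_apply]
    exact congrFun (congrFun (hcomm k) b) j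
  · ext k j
    rw [modelQ_mul_apply]
    have h5 : Q.row k ᵥ* (P⁻¹ * (L k)ᵀ * P) = Y.row k := by
      rw [hQ, vecMul_vecMul, ← Matrix.mul_assoc, ← Matrix.mul_assoc, mul_nonsing_inv _ hdet,
        Matrix.one_mul, ← vecMul_vecMul, vecMul_transpose, hLB, vecMul_vecMul,
        nonsing_inv_mul _ hdet, vecMul_one]
    exact congrFun h5 j

end Model

/-! ### Connectedness and steady states of the edges. -/

namespace NetworkSystem

variable {N M p : ℕ}

theorem H_apply (sys : NetworkSystem N M p) (i : Fin N) (j : Fin M) :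
    sys.H i j = (if i = sys.posEnd j then 1 else 0) - (if i = sys.negEnd j then 1 else 0) := by
  have := sys.ends_ne j
  simp only [H, Matrix.of_apply]
  split_ifs with h1 h2 <;> simp_all

theorem sum_H (sys : NetworkSystem N M p) (j : Fin M) : ∑ i, sys.H i j = 0 := by
  simp [H_apply]

theorem Connected.pos {sys : NetworkSystem N M p} (h : sys.Connected) : 0 < N := by
  have : sys.H.rank + 1 = N := h
  omega

/-- By rank-nullity the kernel of `Hᵀ` is one-dimensional, hence consists of the constants, and a
constant of zero sum vanishes. -/
theorem Connected.eq_zero {sys : NetworkSystem N M p} (h : sys.Connected) {c : Fin N → ℝ}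
    (hc : ∀ j, ∑ i, sys.H i j * c i = 0) (hsum : ∑ i, c i = 0) : c = 0 := by
  have hN := h.pos
  have hr : sys.Hᵀ.rank + 1 = N := by rw [rank_transpose]; exact h
  have hk := LinearMap.finrank_range_add_finrank_ker sys.Hᵀ.mulVecLin
  rw [Module.finrank_fintype_fun_eq_card, Fintype.card_fin] at hk
  have hk1 : Module.finrank ℝ (LinearMap.ker sys.Hᵀ.mulVecLin) = 1 := by
    have : Module.finrank ℝ (LinearMap.range sys.Hᵀ.mulVecLin) = sys.Hᵀ.rank := rfl
    omega
  have hmem : ∀ v : Fin N → ℝ, (∀ j, ∑ i, sys.H i j * v i = 0) →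
      v ∈ LinearMap.ker sys.Hᵀ.mulVecLin := by
    intro v hv
    rw [LinearMap.mem_ker]
    ext j
    exact hv j
  have hone := hmem (fun _ => 1) (by simpa using sys.sum_H)
  have hne : (⟨fun _ => 1, hone⟩ : LinearMap.ker sys.Hᵀ.mulVecLin) ≠ 0 := by
    intro h0
    have := congrFun (congrArg Subtype.val h0) ⟨0, hN⟩
    simp at this
  obtain ⟨a, ha⟩ := (finrank_eq_one_iff_of_nonzero' _ hne).1 hk1 ⟨c, hmem c hc⟩
  have hca : ∀ i, c i = a := by
    intro i
    have := congrFun (congrArg Subtype.val ha) i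
    simpa using this.symm
  simp only [hca, Finset.sum_const, Finset.card_univ, Fintype.card_fin, nsmul_eq_mul] at hsum
  have ha0 : a = 0 := (mul_eq_zero.1 hsum).resolve_left (by positivity)
  ext i
  rw [hca, ha0]; rfl

end NetworkSystem

/-- An energy balance in steady state: `W` acts as an invariant covariance of the modes, so the
storage term `Q Z S W Zᵀ` has zero trace and the supplied power equals the dissipated power. -/
theorem trace_edge_pairing {n p q : ℕ} {E Q : Matrix (Fin n) (Fin n) ℝ}
    {F : Matrix (Fin n) (Fin p) ℝ} {G : Matrix (Fin p) (Fin n) ℝ} {S W : Matrix (Fin q) (Fin q) ℝ}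
    (hQ : Qᵀ = Q) (hQF : Q * F = Gᵀ) (hW : Wᵀ = W) (hSW : S * W + W * Sᵀ = 0)
    {Z : Matrix (Fin n) (Fin q) ℝ} {s : Matrix (Fin p) (Fin q) ℝ} (hZ : Z * S = E * Z + F * s) :
    2 * (s * W * (G * Z)ᵀ).trace = (-(Q * E + Eᵀ * Q) * Z * W * Zᵀ).trace := by
  have h1 : (s * W * (G * Z)ᵀ).trace = (Q * (F * s) * W * Zᵀ).trace := by
    rw [transpose_mul, ← hQF, ← Matrix.mul_assoc, trace_mul_comm]
    simp only [Matrix.mul_assoc]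
  have h2 : F * s = Z * S - E * Z := by rw [hZ]; abel
  have h3 : (Q * (Z * S) * W * Zᵀ).trace = (Q * Z * (W * Sᵀ) * Zᵀ).trace := by
    rw [← trace_transpose]
    simp only [transpose_mul, transpose_transpose, hQ, hW]
    rw [← Matrix.mul_assoc, ← Matrix.mul_assoc, trace_mul_comm]
    simp only [Matrix.mul_assoc]
  have h4 : (Q * (E * Z) * W * Zᵀ).trace = (Eᵀ * Q * Z * W * Zᵀ).trace := by
    rw [← trace_transpose]
    simp only [transpose_mul, transpose_transpose, hQ, hW, ← Matrix.mul_assoc]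
    rw [Matrix.mul_assoc _ Eᵀ Q, trace_mul_comm]
    simp only [Matrix.mul_assoc]
  have h5 : (Q * (Z * S) * W * Zᵀ).trace + (Q * Z * (W * Sᵀ) * Zᵀ).trace = 0 := by
    have : Q * (Z * S) * W * Zᵀ + Q * Z * (W * Sᵀ) * Zᵀ = Q * Z * (S * W + W * Sᵀ) * Zᵀ := by
      simp only [Matrix.mul_add, Matrix.add_mul, Matrix.mul_assoc]
    rw [← trace_add, this, hSW]
    simp
  have h6 : (-(Q * E + Eᵀ * Q) * Z * W * Zᵀ).trace
      = -((Q * (E * Z) * W * Zᵀ).trace + (Eᵀ * Q * Z * W * Zᵀ).trace) := by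
    simp only [Matrix.neg_mul, Matrix.add_mul, trace_neg, trace_add, Matrix.mul_assoc]
  rw [h6, h1, h2, Matrix.mul_sub, Matrix.sub_mul, Matrix.sub_mul, trace_sub]
  linarith

namespace NetworkSystem

variable {N M p : ℕ}

/-- Node outputs and edge states, linear in the modes of `S`, that produce prescribed neighboring
inputs of zero sum. -/
theorem exists_edge_steadyState (sys : NetworkSystem N M p) {q : ℕ}
    {S P : Matrix (Fin q) (Fin q) ℝ} (hP : P.PosDef) (hPS : P * S + Sᵀ * P = 0)
    (hF : ∀ j, (sys.F j).rank = p)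
    (hSPR : ∀ j, IsStrictlyPositiveReal (sys.E j) (sys.F j) (sys.G j)) (hH : sys.Connected)
    (b : Fin N → Matrix (Fin p) (Fin q) ℝ) (hb : ∑ i, b i = 0) :
    ∃ (Y : Fin N → Matrix (Fin p) (Fin q) ℝ) (Z : ∀ j, Matrix (Fin (sys.ne j)) (Fin q) ℝ),
      (∀ j, Z j * S = sys.E j * Z j + sys.F j * ∑ i, sys.H i j • Y i) ∧
      ∀ i, -∑ j, sys.H i j • (sys.G j * Z j) = b i := by
  have hdet : IsUnit P.det := (isUnit_iff_isUnit_det P).1 hP.isUnit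
  have hW := hP.inv
  set W := P⁻¹ with hWdef
  have hWsymm : Wᵀ = W := hW.isHermitian
  have hSW : S * W + W * Sᵀ = 0 := by
    have h1 : W * (P * S + Sᵀ * P) * W = 0 := by rw [hPS]; simp
    rw [← h1, Matrix.mul_add, Matrix.add_mul, ← Matrix.mul_assoc W P, nonsing_inv_mul _ hdet,
      Matrix.one_mul, ← Matrix.mul_assoc W, Matrix.mul_assoc _ P, mul_nonsing_inv _ hdet,
      Matrix.mul_one]
  -- Without the added `∑ k, Y k` the map would ignore a common shift of all `Y i`, and its second
  -- component would always sum to zero over the nodes. The extra term removes both defects and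
  -- keeps the system square.
  let Φ : ((∀ j, Matrix (Fin (sys.ne j)) (Fin q) ℝ) × (Fin N → Matrix (Fin p) (Fin q) ℝ)) →ₗ[ℝ]
      ((∀ j, Matrix (Fin (sys.ne j)) (Fin q) ℝ) × (Fin N → Matrix (Fin p) (Fin q) ℝ)) :=
    { toFun := fun v => (fun j => v.1 j * S - sys.E j * v.1 j - sys.F j * ∑ i, sys.H i j • v.2 i,
        fun i => ∑ j, sys.H i j • (sys.G j * v.1 j) + ∑ k, v.2 k)
      map_add' := by
        intro v w
        refine Prod.ext (funext fun j => ?_) (funext fun i => ?_)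
        · simp only [Prod.fst_add, Prod.snd_add, Pi.add_apply, Matrix.add_mul, Matrix.mul_add,
            smul_add, Finset.sum_add_distrib]
          abel
        · simp only [Prod.fst_add, Prod.snd_add, Pi.add_apply, Matrix.mul_add,
            smul_add, Finset.sum_add_distrib]
          abel
      map_smul' := by
        intro c v
        refine Prod.ext (funext fun j => ?_) (funext fun i => ?_)
        · simp only [Prod.smul_fst, Prod.smul_snd, Pi.smul_apply, Matrix.smul_mul, Matrix.mul_smul,
            RingHom.id_apply, smul_sub, smul_comm _ c, ← Finset.smul_sum]
        · simp only [Prod.smul_fst, Prod.smul_snd, Pi.smul_apply, Matrix.mul_smul,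
            RingHom.id_apply, smul_add, smul_comm _ c, ← Finset.smul_sum] }
  have hinj : Function.Injective Φ := by
    rw [← LinearMap.ker_eq_bot, LinearMap.ker_eq_bot']
    rintro ⟨Z, Y⟩ h0
    have h1 : ∀ j, Z j * S = sys.E j * Z j + sys.F j * ∑ i, sys.H i j • Y i := by
      intro j
      have : Z j * S - sys.E j * Z j - sys.F j * ∑ i, sys.H i j • Y i = 0 :=
        congrFun (congrArg Prod.fst h0) j
      rw [← sub_eq_zero, ← this]
      abel
    have h2 : ∀ i, ∑ j, sys.H i j • (sys.G j * Z j) + ∑ k, Y k = 0 :=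
      fun i => congrFun (congrArg Prod.snd h0) i
    -- Pairing the node equations with `Y i` under `W` gives a sum of nonnegative terms, so each
    -- vanishes: all `Z j` and the total of the `Y i` are zero. Full column rank of `F j` then kills
    -- the edge inputs, and connectedness kills `Y`.
    have hsum : ∑ j, ((∑ i, sys.H i j • Y i) * W * (sys.G j * Z j)ᵀ).trace
        + ((∑ k, Y k) * W * (∑ k, Y k)ᵀ).trace = 0 := by
      have h3 : ∑ i, (Y i * W * (∑ j, sys.H i j • (sys.G j * Z j) + ∑ k, Y k)ᵀ).trace = 0 := by
        simp [h2]
      rw [← h3]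
      simp only [transpose_add, transpose_sum, transpose_smul, Matrix.mul_add, Matrix.mul_sum,
        Matrix.sum_mul, Matrix.mul_smul, Matrix.smul_mul, trace_add, trace_sum, trace_smul,
        Finset.sum_add_distrib]
      rw [Finset.sum_comm]
      congr 1
      rw [Finset.sum_comm]
    choose Q hQ hQE hQF using hSPR
    have hQs : ∀ j, (Q j)ᵀ = Q j := fun j => (hQ j).isHermitian
    have hedge : ∀ j, 0 ≤ ((∑ i, sys.H i j • Y i) * W * (sys.G j * Z j)ᵀ).trace ∧
        (((∑ i, sys.H i j • Y i) * W * (sys.G j * Z j)ᵀ).trace = 0 → Z j = 0) := by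
      intro j
      have h4 := trace_edge_pairing (hQs j) (hQF j) hWsymm hSW (h1 j)
      have h5 := trace_mul_mul_mul_transpose (hQE j) hW.posSemidef (Z j)
      refine ⟨by linarith [h5.1], fun h => hW.eq_zero_of_mul_mul_transpose (h5.2 ?_)⟩
      rw [← h4, h, mul_zero]
    have hpos : ((∑ k, Y k) * W * (∑ k, Y k)ᵀ).PosSemidef :=
      hW.posSemidef.mul_mul_conjTranspose_same _
    have hE0 : 0 ≤ ∑ j, ((∑ i, sys.H i j • Y i) * W * (sys.G j * Z j)ᵀ).trace :=
      Finset.sum_nonneg fun j _ => (hedge j).1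
    have hY0 : ∑ k, Y k = 0 := hW.eq_zero_of_mul_mul_transpose
      (hpos.trace_eq_zero_iff.1 (by linarith [hpos.trace_nonneg]))
    have hZ0 : ∀ j, Z j = 0 := by
      intro j
      refine (hedge j).2 ((Finset.sum_eq_zero_iff_of_nonneg fun j _ => (hedge j).1).1 ?_ j
        (Finset.mem_univ j))
      linarith [hpos.trace_nonneg]
    have hs0 : ∀ j, ∑ i, sys.H i j • Y i = 0 := by
      intro j
      refine mul_left_eq_zero_of_rank_eq (A := sys.F j) (by simpa using hF j) ?_
      have := h1 j
      rw [hZ0 j] at this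
      simpa using this.symm
    refine Prod.ext (funext hZ0) (funext fun i => ?_)
    ext a c
    refine congrFun (hH.eq_zero (c := fun i => Y i a c) (fun j => ?_) ?_) i
    · simpa [Matrix.sum_apply] using congrFun (congrFun (hs0 j) a) c
    · simpa [Matrix.sum_apply] using congrFun (congrFun hY0 a) c
  obtain ⟨⟨Z, Y⟩, hZY⟩ := LinearMap.injective_iff_surjective.1 hinj (0, fun i => -b i)
  have h1 : ∀ j, Z j * S - sys.E j * Z j - sys.F j * ∑ i, sys.H i j • Y i = 0 :=
    fun j => congrFun (congrArg Prod.fst hZY) j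
  have h2 : ∀ i, ∑ j, sys.H i j • (sys.G j * Z j) + ∑ k, Y k = -b i :=
    fun i => congrFun (congrArg Prod.snd hZY) i
  -- Summed over the nodes, the edge terms cancel and leave `N • ∑ k, Y k = 0`, so the auxiliary
  -- term drops out of the solution.
  have hY : ∑ k, Y k = 0 := by
    have h3 : ∑ i, (∑ j, sys.H i j • (sys.G j * Z j) + ∑ k, Y k) = -∑ i, b i := by
      rw [← Finset.sum_neg_distrib]; exact Finset.sum_congr rfl fun i _ => h2 i
    rw [Finset.sum_add_distrib, Finset.sum_comm, hb, neg_zero] at h3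
    simp only [← Finset.sum_smul, sum_H, zero_smul, Finset.sum_const_zero, zero_add,
      Finset.sum_const, Finset.card_univ, Fintype.card_fin] at h3
    rw [← Nat.cast_smul_eq_nsmul ℝ] at h3
    exact (smul_eq_zero.1 h3).resolve_left (Nat.cast_ne_zero.2 hH.pos.ne')
  refine ⟨Y, Z, fun j => ?_, fun i => ?_⟩
  · rw [← sub_eq_zero, ← h1 j]
    abel
  · have := h2 i
    rw [hY, add_zero] at this
    rw [this, neg_neg]

end NetworkSystem

/-! ### Estimates and derivatives of quadratic forms. -/

section Quadratic

variable {ι κ : Type*} [Fintype ι] [Fintype κ]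

theorem dotProduct_self_nonneg_real (x : ι → ℝ) : 0 ≤ x ⬝ᵥ x :=
  Finset.sum_nonneg fun i _ => mul_self_nonneg (x i)

theorem Matrix.dotProduct_mulVec_comm_of_symm {P : Matrix ι ι ℝ} (hP : Pᵀ = P) (x y : ι → ℝ) :
    x ⬝ᵥ (P *ᵥ y) = y ⬝ᵥ (P *ᵥ x) := by
  rw [dotProduct_mulVec, ← mulVec_transpose, hP, dotProduct_comm]

theorem Matrix.exists_mulVec_dotProduct_le (M : Matrix ι κ ℝ) :
    ∃ C : ℝ, 0 ≤ C ∧ ∀ y : κ → ℝ, (M *ᵥ y) ⬝ᵥ (M *ᵥ y) ≤ C * (y ⬝ᵥ y) := by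
  refine ⟨∑ i, ∑ j, M i j ^ 2, by positivity, fun y => ?_⟩
  rw [dotProduct, Finset.sum_mul]
  refine Finset.sum_le_sum fun i _ => ?_
  have := Finset.sum_mul_sq_le_sq_mul_sq Finset.univ (M i) y
  simpa [mulVec, dotProduct, sq] using this

theorem dotProduct_le_young (x w : ι → ℝ) {τ : ℝ} (hτ : 0 < τ) :
    x ⬝ᵥ w ≤ τ * (x ⬝ᵥ x) + (w ⬝ᵥ w) / (4 * τ) := by
  simp only [dotProduct, Finset.mul_sum, Finset.sum_div, ← Finset.sum_add_distrib]
  refine Finset.sum_le_sum fun i _ => ?_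
  have h : τ * (x i * x i) + w i * w i / (4 * τ) - x i * w i
      = (2 * τ * x i - w i) ^ 2 / (4 * τ) := by
    field_simp; ring
  have : 0 ≤ (2 * τ * x i - w i) ^ 2 / (4 * τ) := by positivity
  linarith

theorem HasDerivWithinAt.matrix_mulVec {x : ℝ → κ → ℝ} {x' : κ → ℝ} {s : Set ℝ} {t : ℝ}
    (h : HasDerivWithinAt x x' s t) (M : Matrix ι κ ℝ) :
    HasDerivWithinAt (fun τ => M *ᵥ x τ) (M *ᵥ x') s t :=
  (LinearMap.toContinuousLinearMap M.mulVecLin).hasFDerivAt.comp_hasDerivWithinAt t h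

theorem HasDerivWithinAt.dotProduct_mulVec_self {P : Matrix ι ι ℝ} (hP : Pᵀ = P)
    {x : ℝ → ι → ℝ} {x' : ι → ℝ} {s : Set ℝ} {t : ℝ} (h : HasDerivWithinAt x x' s t) :
    HasDerivWithinAt (fun τ => x τ ⬝ᵥ (P *ᵥ x τ)) (2 * (x t ⬝ᵥ (P *ᵥ x'))) s t := by
  have h1 := hasDerivWithinAt_pi.1 h
  have h2 := hasDerivWithinAt_pi.1 (h.matrix_mulVec P)
  have h3 := HasDerivWithinAt.fun_sum fun i (_ : i ∈ Finset.univ) => (h1 i).mul (h2 i)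
  refine h3.congr_deriv ?_
  rw [Finset.sum_add_distrib, two_mul]
  congr 1
  exact dotProduct_mulVec_comm_of_symm hP x' (x t)

end Quadratic

/-! ### Lyapunov matrices and strict storage functions. -/

section Lyapunov

open scoped Matrix.Norms.L2Operator

variable {ι κ : Type*} [Fintype ι] [DecidableEq ι] [Fintype κ]

/-- Since `|1 + h μ|² = 1 + h (2 Re μ + h |μ|²)`, a small Euler step contracts each mode, and there
are finitely many. -/
theorem IsHurwitz.eventually_norm_lt {A : Matrix ι ι ℝ} (hA : IsHurwitz A) :
    ∀ᶠ h : ℝ in 𝓝[>] 0, ∀ μ : ℂ, (A.map (algebraMap ℝ ℂ)).charpoly.IsRoot μ →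
      ‖1 + (h : ℂ) * μ‖ < 1 := by
  set f := (A.map (algebraMap ℝ ℂ)).charpoly
  have hf : f ≠ 0 := (charpoly_monic _).ne_zero
  have key : ∀ μ ∈ f.roots.toFinset, ∀ᶠ h : ℝ in 𝓝[>] 0, ‖1 + (h : ℂ) * μ‖ < 1 := by
    intro μ hμ
    have hre : μ.re < 0 := hA μ (Polynomial.isRoot_of_mem_roots (Multiset.mem_toFinset.1 hμ))
    have hlim : Tendsto (fun h : ℝ => 2 * μ.re + h * Complex.normSq μ) (𝓝[>] 0)
        (𝓝 (2 * μ.re + 0 * Complex.normSq μ)) :=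
      tendsto_nhdsWithin_of_tendsto_nhds (Continuous.tendsto (by fun_prop) _)
    have hneg := hlim.eventually_lt_const (show 2 * μ.re + 0 * Complex.normSq μ < 0 by linarith)
    filter_upwards [hneg, self_mem_nhdsWithin] with h h1 h2
    have h2' : 0 < h := h2
    have h3 : ‖1 + (h : ℂ) * μ‖ ^ 2 < 1 := by
      rw [← Complex.normSq_eq_norm_sq]
      have : Complex.normSq (1 + (h : ℂ) * μ) = 1 + h * (2 * μ.re + h * Complex.normSq μ) := by
        simp [Complex.normSq_apply]
        ring
      rw [this]
      nlinarith
    exact (sq_lt_one_iff₀ (norm_nonneg _)).1 h3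
  filter_upwards [(eventually_all_finset _).2 key] with h hh μ hμ
  exact hh μ (Multiset.mem_toFinset.2 ((Polynomial.mem_roots hf).2 hμ))

/-- Gelfand's formula for the spectral radius. -/
theorem Matrix.exists_norm_pow_lt_one_of_spectrum [Nonempty ι] {B : Matrix ι ι ℂ}
    (hB : ∀ μ ∈ spectrum ℂ B, ‖μ‖ < 1) : ∃ k : ℕ, 0 < k ∧ ‖B ^ k‖ < 1 := by
  have h1 : spectralRadius ℂ B < (1 : NNReal) :=
    spectrum.spectralRadius_lt_of_forall_lt B fun μ hμ => by exact_mod_cast hB μ hμ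
  have h2 := (spectrum.pow_nnnorm_pow_one_div_tendsto_nhds_spectralRadius B).eventually_lt_const h1
  obtain ⟨k, hk, hk0⟩ := (h2.and (eventually_gt_atTop 0)).exists
  refine ⟨k, hk0, ?_⟩
  have hk1 : (0 : ℝ) < 1 / k := by positivity
  by_contra! hcon
  have h3 : (1 : ENNReal) ≤ (‖B ^ k‖₊ : ENNReal) := by exact_mod_cast hcon
  exact absurd hk (not_lt.2 (ENNReal.one_le_rpow h3 hk1))

theorem Matrix.mulVec_dotProduct_le_norm_map (B : Matrix ι ι ℝ) (x : ι → ℝ) :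
    (B *ᵥ x) ⬝ᵥ (B *ᵥ x) ≤ ‖B.map (algebraMap ℝ ℂ)‖ ^ 2 * (x ⬝ᵥ x) := by
  have hn : ∀ y : ι → ℝ, ‖WithLp.toLp 2 (fun i => (y i : ℂ))‖ ^ 2 = y ⬝ᵥ y := by
    intro y
    rw [EuclideanSpace.norm_sq_eq]
    simp [dotProduct, sq]
  have h1 := l2_opNorm_mulVec (B.map (algebraMap ℝ ℂ)) (WithLp.toLp 2 fun i => (x i : ℂ))
  have h2 : B.map (algebraMap ℝ ℂ) *ᵥ (fun i => (x i : ℂ)) = fun i => (((B *ᵥ x) i : ℝ) : ℂ) := by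
    ext i
    simp [mulVec, dotProduct]
  have h3 : ‖WithLp.toLp 2 (fun i => (((B *ᵥ x) i : ℝ) : ℂ))‖
      ≤ ‖B.map (algebraMap ℝ ℂ)‖ * ‖WithLp.toLp 2 (fun i => (x i : ℂ))‖ := by
    rw [← h2]; exact h1
  rw [← hn, ← hn, ← mul_pow]
  exact pow_le_pow_left₀ (norm_nonneg _) h3 2

/-- The Euler step `B = 1 + h A` has a power `B ^ k` of norm below one. The finite sum `P = ∑ (B ^
n)ᵀ B ^ n` over `n < k` telescopes along `B`, so its form decreases strictly in discrete time.
Expanding in `h` and discarding the nonnegative `h²` term gives decay for the flow of `A`. -/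
theorem IsHurwitz.exists_lyapunov {A : Matrix ι ι ℝ} (hA : IsHurwitz A) :
    ∃ (P : Matrix ι ι ℝ) (c : ℝ), P.PosDef ∧ 0 < c ∧
      ∀ x : ι → ℝ, x ⬝ᵥ (P *ᵥ (A *ᵥ x)) ≤ -(c * (x ⬝ᵥ x)) := by
  rcases isEmpty_or_nonempty ι with he | hne
  · exact ⟨1, 1, PosDef.one, one_pos, fun x => by simp [dotProduct]⟩
  obtain ⟨h, hh, hh0⟩ := (hA.eventually_norm_lt.and self_mem_nhdsWithin).exists
  have hpos : (0 : ℝ) < h := hh0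
  set B : Matrix ι ι ℝ := 1 + h • A with hB
  have hspec : ∀ μ ∈ spectrum ℂ (B.map (algebraMap ℝ ℂ)), ‖μ‖ < 1 := by
    have hBm : B.map (algebraMap ℝ ℂ) = Polynomial.aeval (A.map (algebraMap ℝ ℂ))
        (1 + Polynomial.C (h : ℂ) * Polynomial.X) := by
      ext i j
      simp [hB, Matrix.one_apply, Algebra.algebraMap_eq_smul_one, apply_ite]
    rw [hBm, spectrum.map_polynomial_aeval_of_nonempty _ _ (spectrum.nonempty _)]
    rintro _ ⟨μ, hμ, rfl⟩
    rw [mem_spectrum_iff_isRoot_charpoly] at hμ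
    simpa using hh μ hμ
  obtain ⟨k, hk, hlt⟩ := exists_norm_pow_lt_one_of_spectrum hspec
  have hmap : (B.map (algebraMap ℝ ℂ)) ^ k = (B ^ k).map (algebraMap ℝ ℂ) :=
    (map_pow (algebraMap ℝ ℂ).mapMatrix B k).symm
  rw [hmap] at hlt
  set r := ‖(B ^ k).map (algebraMap ℝ ℂ)‖ with hr
  have hr1 : r ^ 2 < 1 := (sq_lt_one_iff₀ (norm_nonneg _)).2 hlt
  set P : Matrix ι ι ℝ := ∑ n ∈ Finset.range k, (B ^ n)ᵀ * B ^ n with hP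
  have hPxy : ∀ x y : ι → ℝ, x ⬝ᵥ (P *ᵥ y)
      = ∑ n ∈ Finset.range k, (B ^ n *ᵥ x) ⬝ᵥ (B ^ n *ᵥ y) := by
    intro x y
    rw [hP, sum_mulVec, dotProduct_sum]
    refine Finset.sum_congr rfl fun n _ => ?_
    rw [← mulVec_mulVec, dotProduct_mulVec, vecMul_transpose]
  have hsymm : Pᵀ = P := by simp [hP, transpose_sum]
  have hPnonneg : ∀ x : ι → ℝ, 0 ≤ x ⬝ᵥ (P *ᵥ x) := fun x => by
    rw [hPxy]; exact Finset.sum_nonneg fun n _ => dotProduct_self_nonneg_real _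
  have hPge : ∀ x : ι → ℝ, x ⬝ᵥ x ≤ x ⬝ᵥ (P *ᵥ x) := by
    intro x
    have h0 := Finset.single_le_sum (f := fun n => (B ^ n *ᵥ x) ⬝ᵥ (B ^ n *ᵥ x))
      (fun n _ => dotProduct_self_nonneg_real _) (Finset.mem_range.2 hk)
    rw [hPxy]
    simpa using h0
  refine ⟨P, (1 - r ^ 2) / (2 * h), PosDef.of_dotProduct_mulVec_pos hsymm fun {x} hx => ?_,
    div_pos (by linarith) (by linarith), fun x => ?_⟩
  · have h1 : 0 < x ⬝ᵥ x := lt_of_le_of_ne (dotProduct_self_nonneg_real x)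
      fun h => hx (dotProduct_self_eq_zero.1 h.symm)
    exact h1.trans_le (hPge x)
  · have hBx : B *ᵥ x = x + h • (A *ᵥ x) := by
      rw [hB, add_mulVec, one_mulVec, smul_mulVec]
    have htel : (B *ᵥ x) ⬝ᵥ (P *ᵥ (B *ᵥ x)) - x ⬝ᵥ (P *ᵥ x)
        = (B ^ k *ᵥ x) ⬝ᵥ (B ^ k *ᵥ x) - x ⬝ᵥ x := by
      rw [hPxy, hPxy, ← Finset.sum_sub_distrib]
      have := Finset.sum_range_sub (fun n => (B ^ n *ᵥ x) ⬝ᵥ (B ^ n *ᵥ x)) k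
      simpa [mulVec_mulVec, pow_succ] using this
    have hexp : (B *ᵥ x) ⬝ᵥ (P *ᵥ (B *ᵥ x)) = x ⬝ᵥ (P *ᵥ x) + 2 * h * (x ⬝ᵥ (P *ᵥ (A *ᵥ x)))
        + h ^ 2 * ((A *ᵥ x) ⬝ᵥ (P *ᵥ (A *ᵥ x))) := by
      rw [hBx, mulVec_add, mulVec_smul]
      simp only [dotProduct_add, add_dotProduct, smul_dotProduct, dotProduct_smul, smul_eq_mul]
      rw [dotProduct_mulVec_comm_of_symm hsymm (A *ᵥ x) x]
      ring
    have hle := mulVec_dotProduct_le_norm_map (B ^ k) x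
    have hq := mul_nonneg (sq_nonneg h) (hPnonneg (A *ᵥ x))
    rw [← neg_mul, ← neg_div, div_mul_eq_mul_div, le_div_iff₀ (by linarith)]
    linarith

/-- A passive system with Hurwitz dynamics admits a positive definite storage function that is
strictly dissipative up to an arbitrarily small input term, robustly in the input matrix. -/
theorem IsPassive.exists_strict_storage {A : Matrix ι ι ℝ} {B R : Matrix ι κ ℝ}
    {C : Matrix κ ι ℝ} (h : IsPassive A B C) (hA : IsHurwitz A) {θ : ℝ} (hθ : 0 < θ) :
    ∃ (P : Matrix ι ι ℝ) (c : ℝ), P.PosDef ∧ 0 < c ∧ ∀ᶠ ε : ℝ in 𝓝[>] 0,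
      ∀ (x : ι → ℝ) (u : κ → ℝ), x ⬝ᵥ (P *ᵥ (A *ᵥ x + B *ᵥ u - ε • (R *ᵥ u)))
        ≤ u ⬝ᵥ (C *ᵥ x) - c * (x ⬝ᵥ x) + θ * (u ⬝ᵥ u) := by
  obtain ⟨P₀, hP₀, hpass⟩ := h
  obtain ⟨P₁, c₁, hP₁, hc₁, hlyap⟩ := hA.exists_lyapunov
  obtain ⟨K, hK, hKle⟩ := (P₁ * B).exists_mulVec_dotProduct_le
  -- The storage is the passive `P₀` plus `δ` times a Lyapunov matrix `P₁`. By Young's inequality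
  -- the cross term of `δ P₁` with the input costs half of the decay `δ c₁` and, for this `δ`, at
  -- most `θ / 2` of the input allowance. Small `ε` lets the perturbation use the other `θ / 2` and
  -- another quarter of the decay.
  set δ : ℝ := θ * c₁ / (K + 1) with hδ
  have hδ0 : 0 < δ := by positivity
  have hδK : δ * (K / (2 * c₁)) ≤ θ / 2 := by
    rw [hδ]
    have : θ * c₁ / (K + 1) * (K / (2 * c₁)) = θ / 2 * (K / (K + 1)) := by
      field_simp
    rw [this]
    have h1 : K / (K + 1) ≤ 1 := (div_le_one (by linarith)).2 (by linarith)
    nlinarith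
  set P := P₀ + δ • P₁ with hP
  obtain ⟨K', hK', hKle'⟩ := (P * R).exists_mulVec_dotProduct_le
  refine ⟨P, δ * c₁ / 4, hP₁.smul hδ0 |>.posSemidef_add hP₀, by positivity, ?_⟩
  have hev1 : ∀ᶠ ε : ℝ in 𝓝[>] 0, ε < δ * c₁ / 4 :=
    nhdsWithin_le_nhds (gt_mem_nhds (by positivity))
  have hev2 : ∀ᶠ ε : ℝ in 𝓝[>] 0, ε < θ * 2 / (K' + 1) :=
    nhdsWithin_le_nhds (gt_mem_nhds (by positivity))
  filter_upwards [hev1, hev2, self_mem_nhdsWithin] with ε h1 h2 h3 x u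
  have h3' : (0 : ℝ) < ε := h3
  have hx := dotProduct_self_nonneg_real x
  have hu := dotProduct_self_nonneg_real u
  rw [lt_div_iff₀ (by linarith)] at h2
  have e1 := hpass x u
  have e2 := hlyap x
  have e3 : x ⬝ᵥ (P₁ *ᵥ (B *ᵥ u)) ≤ c₁ / 2 * (x ⬝ᵥ x) + K / (2 * c₁) * (u ⬝ᵥ u) := by
    have := dotProduct_le_young x ((P₁ * B) *ᵥ u) (half_pos hc₁)
    rw [← mulVec_mulVec] at this
    have hle := hKle u
    rw [← mulVec_mulVec] at hle
    refine this.trans (add_le_add_right ?_ _)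
    rw [div_mul_eq_mul_div, show 4 * (c₁ / 2) = 2 * c₁ by ring]
    exact div_le_div_of_nonneg_right hle (by positivity)
  have e4 : -(x ⬝ᵥ (P *ᵥ (R *ᵥ u))) ≤ x ⬝ᵥ x + K' / 4 * (u ⬝ᵥ u) := by
    have := dotProduct_le_young (-x) ((P * R) *ᵥ u) one_pos
    have hle := hKle' u
    rw [neg_dotProduct, neg_dotProduct_neg] at this
    rw [mulVec_mulVec]
    linarith
  have hsplit : x ⬝ᵥ (P *ᵥ (A *ᵥ x + B *ᵥ u - ε • (R *ᵥ u)))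
      = x ⬝ᵥ (P₀ *ᵥ (A *ᵥ x + B *ᵥ u)) + δ * (x ⬝ᵥ (P₁ *ᵥ (A *ᵥ x)))
        + δ * (x ⬝ᵥ (P₁ *ᵥ (B *ᵥ u))) + ε * -(x ⬝ᵥ (P *ᵥ (R *ᵥ u))) := by
    rw [mulVec_sub, dotProduct_sub, mulVec_smul, dotProduct_smul, smul_eq_mul, hP, add_mulVec P₀,
      smul_mulVec, dotProduct_add, dotProduct_smul, mulVec_add P₁, dotProduct_add, smul_eq_mul]
    ring
  have f2 := mul_le_mul_of_nonneg_left e2 hδ0.le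
  have f3 := mul_le_mul_of_nonneg_left e3 hδ0.le
  have f4 := mul_le_mul_of_nonneg_left e4 h3'.le
  have f5 := mul_le_mul_of_nonneg_right hδK hu
  have f6 := mul_le_mul_of_nonneg_right h1.le hx
  have f7 : ε * (K' / 4) * (u ⬝ᵥ u) ≤ θ / 2 * (u ⬝ᵥ u) :=
    mul_le_mul_of_nonneg_right (by nlinarith) hu
  rw [hsplit]
  linarith

end Lyapunov

/-! ### Monotone storage and Barbalat's lemma. -/

section Convergence

theorem exists_mul_sq_norm_le {E : Type*} [NormedAddCommGroup E] [NormedSpace ℝ E]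
    [FiniteDimensional ℝ E] {V : E → ℝ} (hV : Continuous V)
    (hhom : ∀ (a : ℝ) (x : E), V (a • x) = a ^ 2 * V x) (hpos : ∀ x, x ≠ 0 → 0 < V x) :
    ∃ c : ℝ, 0 < c ∧ ∀ x, c * ‖x‖ ^ 2 ≤ V x := by
  have h0 : V 0 = 0 := by simpa using hhom 0 0
  rcases subsingleton_or_nontrivial E with hs | hn
  · exact ⟨1, one_pos, fun x => by rw [Subsingleton.elim x 0, h0]; simp⟩
  have : ProperSpace E := FiniteDimensional.proper ℝ E
  obtain ⟨y, hy, hmin⟩ := (isCompact_sphere (0 : E) 1).exists_isMinOn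
    (NormedSpace.sphere_nonempty.2 zero_le_one) hV.continuousOn
  have hy1 : ‖y‖ = 1 := by simpa using hy
  refine ⟨V y, hpos y (by rintro rfl; simp at hy1), fun x => ?_⟩
  rcases eq_or_ne x 0 with rfl | hx
  · simp [h0]
  have hxn : ‖x‖ ≠ 0 := norm_ne_zero_iff.2 hx
  have h1 : V y ≤ V (‖x‖⁻¹ • x) := hmin (by simp [norm_smul, hxn])
  have h2 : V x = ‖x‖ ^ 2 * V (‖x‖⁻¹ • x) := by
    rw [← hhom, smul_smul, mul_inv_cancel₀ hxn, one_smul]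
  rw [h2, mul_comm]
  exact mul_le_mul_of_nonneg_left h1 (sq_nonneg _)

theorem sub_le_of_hasDerivWithinAt_le {V V' : ℝ → ℝ} {C a b : ℝ}
    (hV : ∀ t ≥ 0, HasDerivWithinAt V (V' t) (Set.Ici 0) t) (ha : 0 ≤ a) (hab : a ≤ b)
    (hC : ∀ t ∈ Set.Icc a b, V' t ≤ C) : V b - V a ≤ C * (b - a) := by
  have hd : ∀ t ∈ interior (Set.Icc a b), HasDerivAt V (V' t) t := by
    intro t ht
    rw [interior_Icc] at ht
    exact (hV t (ha.trans ht.1.le)).hasDerivAt (Ici_mem_nhds (ha.trans_lt ht.1))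
  refine (convex_Icc a b).image_sub_le_mul_sub_of_deriv_le (fun t ht => ?_) (fun t ht => ?_)
    (fun t ht => ?_) a (Set.left_mem_Icc.2 hab) b (Set.right_mem_Icc.2 hab) hab
  · exact ((hV t (ha.trans ht.1)).mono fun s hs => ha.trans hs.1).continuousWithinAt
  · exact (hd t ht).differentiableAt.differentiableWithinAt
  · rw [(hd t ht).deriv]
    exact hC t (interior_subset ht)

/-- A form of Barbalat's lemma. -/
theorem tendsto_zero_of_dissipation {V V' f f' : ℝ → ℝ} {L : ℝ}
    (hV : ∀ t ≥ 0, HasDerivWithinAt V (V' t) (Set.Ici 0) t) (hV0 : ∀ t ≥ 0, 0 ≤ V t)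
    (hle : ∀ t ≥ 0, V' t ≤ -f t) (hf0 : ∀ t ≥ 0, 0 ≤ f t)
    (hf : ∀ t ≥ 0, HasDerivWithinAt f (f' t) (Set.Ici 0) t) (hL : ∀ t ≥ 0, |f' t| ≤ L) :
    Tendsto f atTop (𝓝 0) := by
  have hanti : Antitone fun t => V (max t 0) := by
    intro s t hst
    have := sub_le_of_hasDerivWithinAt_le (C := 0) hV (le_max_right s 0)
      (max_le_max_right 0 hst) fun r hr => by
        have hr0 : 0 ≤ r := (le_max_right s 0).trans hr.1
        linarith [hle r hr0, hf0 r hr0]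
    simp only
    linarith
  have hlim : Tendsto V atTop (𝓝 (⨅ t, V (max t 0))) := by
    refine (tendsto_atTop_ciInf hanti ⟨0, ?_⟩).congr' ?_
    · rintro _ ⟨t, rfl⟩
      exact hV0 _ (le_max_right t 0)
    · filter_upwards [eventually_ge_atTop 0] with t ht
      rw [max_eq_left ht]
  have hL0 : 0 ≤ L := (abs_nonneg _).trans (hL 0 le_rfl)
  rw [Metric.tendsto_atTop]
  intro δ hδ
  -- As the slope of `f` is at most `L`, a value `f t ≥ δ` keeps `f` above `δ / 2` on a window of
  -- length `h`. There `V` would drop by at least `δ / 2 * h`, which is impossible late because `V`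
  -- converges.
  set h : ℝ := δ / (2 * (L + 1)) with hh
  have hhpos : 0 < h := by positivity
  have hLh : L * h ≤ δ / 2 := by
    rw [hh, ← mul_div_assoc, div_le_iff₀ (by positivity)]
    nlinarith
  have hdiff : Tendsto (fun t => V t - V (t + h)) atTop (𝓝 0) := by
    simpa using hlim.sub (hlim.comp (tendsto_atTop_add_const_right atTop h tendsto_id))
  obtain ⟨T, hT⟩ := eventually_atTop.1
    ((hdiff.eventually_lt_const (show (0 : ℝ) < δ / 2 * h by positivity)).and
      (eventually_ge_atTop 0))
  refine ⟨T, fun t ht => ?_⟩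
  obtain ⟨h1, ht0⟩ := hT t ht
  rw [Real.dist_eq, sub_zero, abs_of_nonneg (hf0 t ht0)]
  by_contra! hcon
  have hlow : ∀ s ∈ Set.Icc t (t + h), δ / 2 ≤ f s := by
    intro s hs
    have h2 := sub_le_of_hasDerivWithinAt_le (C := L) (V := fun s => -f s)
      (fun r hr => (hf r hr).neg) ht0 hs.1 fun r hr => by
        have := abs_le.1 (hL r (ht0.trans hr.1))
        linarith
    have h3 : L * (s - t) ≤ L * h := mul_le_mul_of_nonneg_left (by linarith [hs.2]) hL0
    linarith
  have h4 := sub_le_of_hasDerivWithinAt_le (C := -(δ / 2)) hV ht0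
    (show t ≤ t + h by linarith) fun r hr => by
      linarith [hle r (ht0.trans hr.1), hlow r hr]
  nlinarith

end Convergence

/-! ### Comparison of quadratic functions and decay of the interconnection. -/

section Homogeneous

theorem exists_le_mul_of_homogeneous {E : Type*} [NormedAddCommGroup E] [NormedSpace ℝ E]
    [FiniteDimensional ℝ E] {U V : E → ℝ} (hU : Continuous U) (hV : Continuous V)
    (hUhom : ∀ (a : ℝ) (x : E), U (a • x) = a ^ 2 * U x)
    (hVhom : ∀ (a : ℝ) (x : E), V (a • x) = a ^ 2 * V x) (hpos : ∀ x, x ≠ 0 → 0 < V x) :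
    ∃ K : ℝ, 0 < K ∧ ∀ x, U x ≤ K * V x := by
  obtain ⟨c, hc, hcV⟩ := exists_mul_sq_norm_le hV hVhom hpos
  have : ProperSpace E := FiniteDimensional.proper ℝ E
  obtain ⟨K, hK⟩ := (isCompact_closedBall (0 : E) 1).exists_bound_of_continuousOn hU.continuousOn
  have hK0 : 0 ≤ K := (norm_nonneg _).trans (hK 0 (by simp))
  refine ⟨(K + 1) / c, by positivity, fun x => ?_⟩
  have h1 : U x ≤ (K + 1) * ‖x‖ ^ 2 := by
    rcases eq_or_ne x 0 with rfl | hx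
    · have : U 0 = 0 := by simpa using hUhom 0 0
      simp [this]
    · have hxn : ‖x‖ ≠ 0 := norm_ne_zero_iff.2 hx
      have h2 : U x = ‖x‖ ^ 2 * U (‖x‖⁻¹ • x) := by
        rw [← hUhom, smul_smul, mul_inv_cancel₀ hxn, one_smul]
      have h3 : U (‖x‖⁻¹ • x) ≤ K + 1 := by
        have := hK (‖x‖⁻¹ • x) (by simp [norm_smul, hxn])
        linarith [le_abs_self (U (‖x‖⁻¹ • x)), Real.norm_eq_abs (U (‖x‖⁻¹ • x))]
      rw [h2, mul_comm]
      exact mul_le_mul_of_nonneg_right h3 (sq_nonneg _)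
  have h4 := mul_le_mul_of_nonneg_left (hcV x) (show 0 ≤ (K + 1) / c by positivity)
  have h5 : (K + 1) / c * (c * ‖x‖ ^ 2) = (K + 1) * ‖x‖ ^ 2 := by field_simp
  linarith

theorem tendsto_zero_of_dotProduct_self {ι α : Type*} [Fintype ι] {l : Filter α} {x : α → ι → ℝ}
    (h : Tendsto (fun t => x t ⬝ᵥ x t) l (𝓝 0)) : Tendsto x l (𝓝 0) := by
  rw [tendsto_pi_nhds]
  intro i
  have h1 : Tendsto (fun t => √(x t ⬝ᵥ x t)) l (𝓝 0) := by simpa using h.sqrt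
  refine squeeze_zero_norm (fun t => ?_) h1
  rw [Real.norm_eq_abs, ← Real.sqrt_sq_eq_abs]
  refine Real.sqrt_le_sqrt ?_
  rw [sq]
  exact Finset.single_le_sum (f := fun i => x t i * x t i) (fun j _ => mul_self_nonneg _)
    (Finset.mem_univ i)

theorem HasDerivWithinAt.dotProduct_self {ι : Type*} [Fintype ι] {x : ℝ → ι → ℝ} {x' : ι → ℝ}
    {s : Set ℝ} {t : ℝ} (h : HasDerivWithinAt x x' s t) :
    HasDerivWithinAt (fun τ => x τ ⬝ᵥ x τ) (2 * (x t ⬝ᵥ x')) s t := by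
  classical
  simpa using h.dotProduct_mulVec_self (P := 1) transpose_one

theorem dotProduct_self_pos_real {ι : Type*} [Fintype ι] {x : ι → ℝ} (hx : x ≠ 0) :
    0 < x ⬝ᵥ x :=
  lt_of_le_of_ne (dotProduct_self_nonneg_real x) fun h => hx (dotProduct_self_eq_zero.1 h.symm)

theorem Matrix.PosDef.exists_mul_dotProduct_le {ι : Type*} [Fintype ι] {P : Matrix ι ι ℝ}
    (hP : P.PosDef) : ∃ c : ℝ, 0 < c ∧ ∀ x : ι → ℝ, c * (x ⬝ᵥ x) ≤ x ⬝ᵥ (P *ᵥ x) := by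
  obtain ⟨K, hK, h⟩ := exists_le_mul_of_homogeneous (E := ι → ℝ) (U := fun x => x ⬝ᵥ x)
    (V := fun x => x ⬝ᵥ (P *ᵥ x)) (by fun_prop) (by fun_prop)
    (fun a x => by simp only [smul_dotProduct, dotProduct_smul, smul_eq_mul]; ring)
    (fun a x => by
      simp only [mulVec_smul, smul_dotProduct, dotProduct_smul, smul_eq_mul]; ring)
    (fun x hx => hP.dotProduct_mulVec_pos hx)
  refine ⟨K⁻¹, by positivity, fun x => ?_⟩
  rw [inv_mul_le_iff₀ hK]
  exact h x

theorem IsStrictlyPositiveReal.exists_strict_storage {ι κ : Type*} [Fintype ι] [Fintype κ]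
    {E : Matrix ι ι ℝ} {F : Matrix ι κ ℝ} {G : Matrix κ ι ℝ} (h : IsStrictlyPositiveReal E F G) :
    ∃ (Q : Matrix ι ι ℝ) (c : ℝ), Q.PosDef ∧ 0 < c ∧ ∀ (z : ι → ℝ) (s : κ → ℝ),
      z ⬝ᵥ (Q *ᵥ (E *ᵥ z + F *ᵥ s)) ≤ (G *ᵥ z) ⬝ᵥ s - c * (z ⬝ᵥ z) := by
  obtain ⟨Q, hQ, hQE, hQF⟩ := h
  obtain ⟨c, hc, hle⟩ := hQE.exists_mul_dotProduct_le
  have hsymm : Qᵀ = Q := hQ.isHermitian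
  refine ⟨Q, c / 2, hQ, by positivity, fun z s => ?_⟩
  have h1 := hle z
  have h2 : z ⬝ᵥ ((Eᵀ * Q) *ᵥ z) = z ⬝ᵥ ((Q * E) *ᵥ z) := by
    rw [← mulVec_mulVec, dotProduct_mulVec, vecMul_transpose, ← mulVec_mulVec,
      dotProduct_mulVec_comm_of_symm hsymm]
  rw [neg_mulVec, dotProduct_neg, add_mulVec, dotProduct_add, h2] at h1
  have h3 : z ⬝ᵥ (Q *ᵥ (F *ᵥ s)) = (G *ᵥ z) ⬝ᵥ s := by
    rw [mulVec_mulVec, hQF, dotProduct_mulVec, vecMul_transpose]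
  rw [mulVec_add, dotProduct_add, h3, mulVec_mulVec]
  linarith

namespace NetworkSystem

variable {N M p : ℕ}

/-- The interconnection is power preserving. -/
theorem power_balance (sys : NetworkSystem N M p) (z : ∀ j, Fin (sys.ne j) → ℝ)
    (y : Fin N → Fin p → ℝ) :
    ∑ i, sys.neighboringInput z i ⬝ᵥ y i
      + ∑ j, (sys.G j *ᵥ z j) ⬝ᵥ (∑ i, sys.H i j • y i) = 0 := by
  simp only [neighboringInput, edgeOutput, neg_dotProduct, sum_dotProduct, dotProduct_sum,
    smul_dotProduct, dotProduct_smul, Finset.sum_neg_distrib]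
  rw [Finset.sum_comm, neg_add_cancel]

theorem continuous_neighboringInput (sys : NetworkSystem N M p) (i : Fin N) :
    Continuous fun z => sys.neighboringInput z i := by
  unfold neighboringInput edgeOutput
  fun_prop

theorem neighboringInput_smul (sys : NetworkSystem N M p) (a : ℝ) (z : ∀ j, Fin (sys.ne j) → ℝ)
    (i : Fin N) : sys.neighboringInput (a • z) i = a • sys.neighboringInput z i := by
  simp only [neighboringInput, edgeOutput, Pi.smul_apply, mulVec_smul, smul_comm _ a,
    ← Finset.smul_sum, smul_neg]

theorem exists_sum_neighboringInput_le (sys : NetworkSystem N M p) {c : Fin M → ℝ}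
    (hc : ∀ j, 0 < c j) : ∃ K : ℝ, 0 < K ∧ ∀ z : ∀ j, Fin (sys.ne j) → ℝ,
      ∑ i, sys.neighboringInput z i ⬝ᵥ sys.neighboringInput z i
        ≤ K * ∑ j, c j * (z j ⬝ᵥ z j) := by
  have hcont := sys.continuous_neighboringInput
  refine exists_le_mul_of_homogeneous (E := ∀ j, Fin (sys.ne j) → ℝ)
    (U := fun z => ∑ i, sys.neighboringInput z i ⬝ᵥ sys.neighboringInput z i)
    (V := fun z => ∑ j, c j * (z j ⬝ᵥ z j)) (by fun_prop) (by fun_prop) ?_ ?_ ?_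
  · intro a z
    simp only [neighboringInput_smul, smul_dotProduct, dotProduct_smul, smul_eq_mul,
      Finset.mul_sum]
    exact Finset.sum_congr rfl fun i _ => by ring
  · intro a z
    simp only [Pi.smul_apply, smul_dotProduct, dotProduct_smul, smul_eq_mul, Finset.mul_sum]
    exact Finset.sum_congr rfl fun i _ => by ring
  · intro z hz
    obtain ⟨j, hj⟩ := Function.ne_iff.1 hz
    exact Finset.sum_pos' (fun k _ => mul_nonneg (hc k).le (dotProduct_self_nonneg_real _))
      ⟨j, Finset.mem_univ j, mul_pos (hc j) (dotProduct_self_pos_real hj)⟩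

/-- Passive Hurwitz nodes, strictly positive real edges and passive adaptive references: the
node and edge states converge to zero when the adaptation gain is small. -/
theorem eventually_tendsto_zero (sys : NetworkSystem N M p)
    (hSPR : ∀ j, IsStrictlyPositiveReal (sys.E j) (sys.F j) (sys.G j))
    {d : Fin N → Type*} [∀ i, Fintype (d i)] [∀ i, DecidableEq (d i)]
    {A : ∀ i, Matrix (d i) (d i) ℝ} {D R : ∀ i, Matrix (d i) (Fin p) ℝ}
    {C : ∀ i, Matrix (Fin p) (d i) ℝ} (hA : ∀ i, IsHurwitz (A i))
    (hpass : ∀ i, IsPassive (A i) (D i) (C i))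
    {o : Type*} [Fintype o] {S P : Matrix o o ℝ} {B : Matrix o (Fin p) ℝ}
    {Q : Matrix (Fin p) o ℝ} (hP : P.PosDef) (hPS : (-(P * S + Sᵀ * P)).PosSemidef)
    (hPB : P * B = Qᵀ) :
    ∀ᶠ ε : ℝ in 𝓝[>] 0, ∀ (ξ : ℝ → ∀ i, d i → ℝ) (z : ℝ → ∀ j, Fin (sys.ne j) → ℝ)
      (η : ℝ → Fin N → o → ℝ),
      (∀ i, ∀ t ≥ 0, HasDerivWithinAt (fun τ => ξ τ i)
        (A i *ᵥ ξ t i + D i *ᵥ sys.neighboringInput (z t) i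
          - ε • (R i *ᵥ sys.neighboringInput (z t) i)) (Set.Ici 0) t) →
      (∀ j, ∀ t ≥ 0, HasDerivWithinAt (fun τ => z τ j)
        (sys.E j *ᵥ z t j + sys.F j *ᵥ ∑ i, sys.H i j • (C i *ᵥ ξ t i + Q *ᵥ η t i))
        (Set.Ici 0) t) →
      (∀ i, ∀ t ≥ 0, HasDerivWithinAt (fun τ => η τ i)
        (S *ᵥ η t i + ε • (B *ᵥ sys.neighboringInput (z t) i)) (Set.Ici 0) t) →
      (∀ i, Tendsto (fun t => ξ t i) atTop (𝓝 0)) ∧ ∀ j, Tendsto (fun t => z t j) atTop (𝓝 0) := by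
  choose PE cE hPE hcE hedge using fun j => (hSPR j).exists_strict_storage
  obtain ⟨K, hK, hKle⟩ := sys.exists_sum_neighboringInput_le hcE
  -- With this allowance the input terms of all nodes, doubled by differentiation, cost at most half
  -- of the dissipation of the edges.
  have hθ : (0 : ℝ) < 1 / (2 * K) := by positivity
  choose PN cN hPN hcN hnode using
    fun i => (hpass i).exists_strict_storage (R := R i) (hA i) hθ
  have hPsymm : Pᵀ = P := hP.isHermitian
  have hPEsymm : ∀ j, (PE j)ᵀ = PE j := fun j => (hPE j).isHermitian
  have hPNsymm : ∀ i, (PN i)ᵀ = PN i := fun i => (hPN i).isHermitian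
  have hPS' : ∀ x : o → ℝ, x ⬝ᵥ (P *ᵥ (S *ᵥ x)) ≤ 0 := by
    intro x
    have h1 : 0 ≤ x ⬝ᵥ ((-(P * S + Sᵀ * P)) *ᵥ x) := hPS.dotProduct_mulVec_nonneg x
    have h2 : x ⬝ᵥ ((Sᵀ * P) *ᵥ x) = x ⬝ᵥ ((P * S) *ᵥ x) := by
      rw [← mulVec_mulVec, dotProduct_mulVec, vecMul_transpose, ← mulVec_mulVec,
        dotProduct_mulVec_comm_of_symm hPsymm]
    rw [neg_mulVec, dotProduct_neg, add_mulVec, dotProduct_add, h2, ← mulVec_mulVec] at h1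
    linarith
  filter_upwards [eventually_all.2 hnode, self_mem_nhdsWithin] with ε hε hε0 ξ z η hξ hz hη
  have hε0' : (0 : ℝ) < ε := hε0
  let v : (∀ j, Fin (sys.ne j) → ℝ) → Fin N → Fin p → ℝ := sys.neighboringInput
  have hvcont : ∀ i, Continuous fun z => v z i := sys.continuous_neighboringInput
  -- The factor `ε⁻¹` makes the supply rate of the reference model `v · Q η`, independent of the
  -- gain, so that it cancels in the power balance.
  let V : (∀ i, d i → ℝ) × (∀ j, Fin (sys.ne j) → ℝ) × (Fin N → o → ℝ) → ℝ := fun X =>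
    ∑ i, X.1 i ⬝ᵥ (PN i *ᵥ X.1 i) + ∑ j, X.2.1 j ⬝ᵥ (PE j *ᵥ X.2.1 j)
      + ∑ i, ε⁻¹ * (X.2.2 i ⬝ᵥ (P *ᵥ X.2.2 i))
  let ξ' : (∀ i, d i → ℝ) × (∀ j, Fin (sys.ne j) → ℝ) × (Fin N → o → ℝ) → ∀ i, d i → ℝ :=
    fun X i => A i *ᵥ X.1 i + D i *ᵥ v X.2.1 i - ε • (R i *ᵥ v X.2.1 i)
  let z' : (∀ i, d i → ℝ) × (∀ j, Fin (sys.ne j) → ℝ) × (Fin N → o → ℝ) →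
      ∀ j, Fin (sys.ne j) → ℝ := fun X j =>
    sys.E j *ᵥ X.2.1 j + sys.F j *ᵥ ∑ i, sys.H i j • (C i *ᵥ X.1 i + Q *ᵥ X.2.2 i)
  let η' : (∀ i, d i → ℝ) × (∀ j, Fin (sys.ne j) → ℝ) × (Fin N → o → ℝ) → Fin N → o → ℝ :=
    fun X i => S *ᵥ X.2.2 i + ε • (B *ᵥ v X.2.1 i)
  let V' : (∀ i, d i → ℝ) × (∀ j, Fin (sys.ne j) → ℝ) × (Fin N → o → ℝ) → ℝ := fun X =>
    ∑ i, 2 * (X.1 i ⬝ᵥ (PN i *ᵥ ξ' X i)) + ∑ j, 2 * (X.2.1 j ⬝ᵥ (PE j *ᵥ z' X j))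
      + ∑ i, ε⁻¹ * (2 * (X.2.2 i ⬝ᵥ (P *ᵥ η' X i)))
  -- There is no `η` term: the reference models need not decay.
  let f : (∀ i, d i → ℝ) × (∀ j, Fin (sys.ne j) → ℝ) × (Fin N → o → ℝ) → ℝ := fun X =>
    ∑ i, 2 * cN i * (X.1 i ⬝ᵥ X.1 i) + ∑ j, cE j * (X.2.1 j ⬝ᵥ X.2.1 j)
  let f' : (∀ i, d i → ℝ) × (∀ j, Fin (sys.ne j) → ℝ) × (Fin N → o → ℝ) → ℝ := fun X =>
    ∑ i, 2 * cN i * (2 * (X.1 i ⬝ᵥ ξ' X i)) + ∑ j, cE j * (2 * (X.2.1 j ⬝ᵥ z' X j))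
  have hξ'cont : ∀ i, Continuous fun X => ξ' X i := by
    intro i
    have := (hvcont i).comp (continuous_fst.comp continuous_snd :
      Continuous fun X : (∀ i, d i → ℝ) × (∀ j, Fin (sys.ne j) → ℝ) × (Fin N → o → ℝ) => X.2.1)
    simp only [ξ']
    fun_prop
  have hz'cont : ∀ j, Continuous fun X => z' X j := by
    intro j
    simp only [z']
    fun_prop
  have hf'cont : Continuous f' := by
    simp only [f']
    fun_prop
  have hVcont : Continuous V := by
    simp only [V]
    fun_prop
  have hdiss : ∀ X, V' X ≤ -f X := by
    rintro ⟨a, b, c⟩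
    have h1 : ∀ i, 2 * (a i ⬝ᵥ (PN i *ᵥ ξ' (a, b, c) i)) ≤ 2 * (v b i ⬝ᵥ (C i *ᵥ a i))
        - 2 * cN i * (a i ⬝ᵥ a i) + K⁻¹ * (v b i ⬝ᵥ v b i) := by
      intro i
      have := hε i (a i) (v b i)
      have hKi : 2 * (1 / (2 * K)) = K⁻¹ := by field_simp
      rw [← hKi]
      linarith
    have h2 : ∀ j, 2 * (b j ⬝ᵥ (PE j *ᵥ z' (a, b, c) j))
        ≤ 2 * ((sys.G j *ᵥ b j) ⬝ᵥ ∑ i, sys.H i j • (C i *ᵥ a i + Q *ᵥ c i))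
          - 2 * (cE j * (b j ⬝ᵥ b j)) := by
      intro j
      have := hedge j (b j) (∑ i, sys.H i j • (C i *ᵥ a i + Q *ᵥ c i))
      linarith
    have h3 : ∀ i, ε⁻¹ * (2 * (c i ⬝ᵥ (P *ᵥ η' (a, b, c) i))) ≤ 2 * (v b i ⬝ᵥ (Q *ᵥ c i)) := by
      intro i
      have e1 : c i ⬝ᵥ (P *ᵥ η' (a, b, c) i)
          = c i ⬝ᵥ (P *ᵥ (S *ᵥ c i)) + ε * (v b i ⬝ᵥ (Q *ᵥ c i)) := by
        simp only [η']
        rw [mulVec_add, dotProduct_add, mulVec_smul, dotProduct_smul, mulVec_mulVec _ P B, hPB,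
          dotProduct_mulVec _ Qᵀ, vecMul_transpose, dotProduct_comm (Q *ᵥ c i), smul_eq_mul]
      rw [e1, inv_mul_le_iff₀ hε0']
      linarith [hPS' (c i)]
    have s1 := Finset.sum_le_sum fun i (_ : i ∈ Finset.univ) => h1 i
    have s2 := Finset.sum_le_sum fun j (_ : j ∈ Finset.univ) => h2 j
    have s3 := Finset.sum_le_sum fun i (_ : i ∈ Finset.univ) => h3 i
    have hbal := sys.power_balance b fun i => C i *ᵥ a i + Q *ᵥ c i
    have hin : K⁻¹ * ∑ i, v b i ⬝ᵥ v b i ≤ ∑ j, cE j * (b j ⬝ᵥ b j) := by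
      rw [inv_mul_le_iff₀ hK]
      exact hKle b
    simp only [dotProduct_add, Finset.sum_add_distrib] at hbal
    simp only [Finset.sum_add_distrib, Finset.sum_sub_distrib, ← Finset.mul_sum] at s1 s2 s3
    have hVV : V' (a, b, c) = 2 * ∑ i, a i ⬝ᵥ (PN i *ᵥ ξ' (a, b, c) i)
        + 2 * ∑ j, b j ⬝ᵥ (PE j *ᵥ z' (a, b, c) j)
        + ε⁻¹ * (2 * ∑ i, c i ⬝ᵥ (P *ᵥ η' (a, b, c) i)) := by
      simp only [V', ← Finset.mul_sum]
    have hff : f (a, b, c) = ∑ i, 2 * cN i * (a i ⬝ᵥ a i) + ∑ j, cE j * (b j ⬝ᵥ b j) := rfl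
    rw [hVV, hff]
    linarith
  have hVhom : ∀ (r : ℝ) X, V (r • X) = r ^ 2 * V X := by
    intro r X
    simp only [V, Prod.smul_fst, Prod.smul_snd, Pi.smul_apply, mulVec_smul, smul_dotProduct,
      dotProduct_smul, smul_eq_mul, mul_add, Finset.mul_sum]
    congr 1
    · congr 1
      · exact Finset.sum_congr rfl fun i _ => by ring
      · exact Finset.sum_congr rfl fun i _ => by ring
    · exact Finset.sum_congr rfl fun i _ => by ring
  have hN0 : ∀ i (x : d i → ℝ), 0 ≤ x ⬝ᵥ (PN i *ᵥ x) :=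
    fun i x => (hPN i).posSemidef.dotProduct_mulVec_nonneg x
  have hE0 : ∀ j (x : Fin (sys.ne j) → ℝ), 0 ≤ x ⬝ᵥ (PE j *ᵥ x) :=
    fun j x => (hPE j).posSemidef.dotProduct_mulVec_nonneg x
  have hP0 : ∀ x : o → ℝ, 0 ≤ ε⁻¹ * (x ⬝ᵥ (P *ᵥ x)) :=
    fun x => mul_nonneg (by positivity) (hP.posSemidef.dotProduct_mulVec_nonneg x)
  have hVpos : ∀ X, X ≠ 0 → 0 < V X := by
    rintro ⟨a, b, c⟩ hX
    have ha : 0 ≤ ∑ i, a i ⬝ᵥ (PN i *ᵥ a i) := Finset.sum_nonneg fun i _ => hN0 i _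
    have hb : 0 ≤ ∑ j, b j ⬝ᵥ (PE j *ᵥ b j) := Finset.sum_nonneg fun j _ => hE0 j _
    have hc : 0 ≤ ∑ i, ε⁻¹ * (c i ⬝ᵥ (P *ᵥ c i)) := Finset.sum_nonneg fun i _ => hP0 _
    by_contra! hcon
    have hV0 : V (a, b, c) = ∑ i, a i ⬝ᵥ (PN i *ᵥ a i) + ∑ j, b j ⬝ᵥ (PE j *ᵥ b j)
      + ∑ i, ε⁻¹ * (c i ⬝ᵥ (P *ᵥ c i)) := rfl
    rw [hV0] at hcon
    refine hX (Prod.ext (funext fun i => ?_) (Prod.ext (funext fun j => ?_) (funext fun i => ?_)))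
    · by_contra hne
      have := (hPN i).dotProduct_mulVec_pos hne
      have h2 := Finset.single_le_sum (f := fun i => a i ⬝ᵥ (PN i *ᵥ a i))
        (fun i _ => hN0 i _) (Finset.mem_univ i)
      simp only [star_trivial] at this
      linarith
    · by_contra hne
      have := (hPE j).dotProduct_mulVec_pos hne
      have h2 := Finset.single_le_sum (f := fun j => b j ⬝ᵥ (PE j *ᵥ b j))
        (fun j _ => hE0 j _) (Finset.mem_univ j)
      simp only [star_trivial] at this
      linarith
    · by_contra hne
      have := mul_pos (inv_pos.2 hε0') (hP.dotProduct_mulVec_pos hne)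
      have h2 := Finset.single_le_sum (f := fun i => ε⁻¹ * (c i ⬝ᵥ (P *ᵥ c i)))
        (fun i _ => hP0 _) (Finset.mem_univ i)
      simp only [star_trivial] at this
      linarith
  let X : ℝ → (∀ i, d i → ℝ) × (∀ j, Fin (sys.ne j) → ℝ) × (Fin N → o → ℝ) :=
    fun t => (ξ t, z t, η t)
  have hVder : ∀ t ≥ 0, HasDerivWithinAt (fun τ => V (X τ)) (V' (X t)) (Set.Ici 0) t := by
    intro t ht
    refine ((HasDerivWithinAt.fun_sum fun i _ => ?_).add
      (HasDerivWithinAt.fun_sum fun j _ => ?_)).add (HasDerivWithinAt.fun_sum fun i _ => ?_)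
    · exact (hξ i t ht).dotProduct_mulVec_self (hPNsymm i)
    · exact (hz j t ht).dotProduct_mulVec_self (hPEsymm j)
    · exact ((hη i t ht).dotProduct_mulVec_self hPsymm).const_mul _
  have hfder : ∀ t ≥ 0, HasDerivWithinAt (fun τ => f (X τ)) (f' (X t)) (Set.Ici 0) t := by
    intro t ht
    refine (HasDerivWithinAt.fun_sum fun i _ => ?_).add (HasDerivWithinAt.fun_sum fun j _ => ?_)
    · exact (hξ i t ht).dotProduct_self.const_mul _
    · exact (hz j t ht).dotProduct_self.const_mul _
  have hfN : ∀ (X : ∀ i, d i → ℝ) i, 0 ≤ 2 * cN i * (X i ⬝ᵥ X i) := fun X i =>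
    mul_nonneg (by linarith [hcN i]) (dotProduct_self_nonneg_real _)
  have hfE : ∀ (X : ∀ j, Fin (sys.ne j) → ℝ) j, 0 ≤ cE j * (X j ⬝ᵥ X j) := fun X j =>
    mul_nonneg (hcE j).le (dotProduct_self_nonneg_real _)
  have hf0 : ∀ X, 0 ≤ f X := fun X =>
    add_nonneg (Finset.sum_nonneg fun i _ => hfN X.1 i) (Finset.sum_nonneg fun j _ => hfE X.2.1 j)
  have hV0 : ∀ X, 0 ≤ V X := fun X =>
    add_nonneg (add_nonneg (Finset.sum_nonneg fun i _ => hN0 i _)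
      (Finset.sum_nonneg fun j _ => hE0 j _)) (Finset.sum_nonneg fun i _ => hP0 _)
  -- `V` is positive definite in all variables, `η` included, so the trajectory stays in a ball, on
  -- which the continuous `f'` is bounded as Barbalat's lemma requires.
  obtain ⟨r, hr, hrV⟩ := exists_mul_sq_norm_le hVcont hVhom hVpos
  have hbdd : ∀ t ≥ 0, X t ∈ Metric.closedBall 0 (√(V (X 0) / r)) := by
    intro t ht
    have h1 := sub_le_of_hasDerivWithinAt_le (C := 0) hVder le_rfl ht fun s _ => by
      linarith [hdiss (X s), hf0 (X s)]
    rw [mem_closedBall_zero_iff]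
    refine Real.le_sqrt_of_sq_le ?_
    rw [le_div_iff₀ hr]
    linarith [hrV (X t)]
  obtain ⟨L, hL⟩ := (isCompact_closedBall _ _).exists_bound_of_continuousOn
    (hf'cont.continuousOn (s := Metric.closedBall 0 (√(V (X 0) / r))))
  have hlim : Tendsto (fun t => f (X t)) atTop (𝓝 0) :=
    tendsto_zero_of_dissipation hVder (fun t _ => hV0 _) (fun t _ => hdiss _) (fun t _ => hf0 _)
      hfder fun t ht => hL _ (hbdd t ht)
  refine ⟨fun i => tendsto_zero_of_dotProduct_self ?_, fun j => tendsto_zero_of_dotProduct_self ?_⟩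
  · have h1 : Tendsto (fun t => (2 * cN i)⁻¹ * f (X t)) atTop (𝓝 0) := by
      simpa using hlim.const_mul (2 * cN i)⁻¹
    refine squeeze_zero (fun t => dotProduct_self_nonneg_real _) (fun t => ?_) h1
    rw [← div_eq_inv_mul, le_div_iff₀ (by linarith [hcN i]), mul_comm]
    exact (Finset.single_le_sum (fun i _ => hfN (ξ t) i) (Finset.mem_univ i)).trans
      (le_add_of_nonneg_right (Finset.sum_nonneg fun j _ => hfE (z t) j))
  · have h1 : Tendsto (fun t => (cE j)⁻¹ * f (X t)) atTop (𝓝 0) := by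
      simpa using hlim.const_mul (cE j)⁻¹
    refine squeeze_zero (fun t => dotProduct_self_nonneg_real _) (fun t => ?_) h1
    rw [← div_eq_inv_mul, le_div_iff₀ (hcE j), mul_comm]
    exact (Finset.single_le_sum (fun j _ => hfE (z t) j) (Finset.mem_univ j)).trans
      (le_add_of_nonneg_left (Finset.sum_nonneg fun i _ => hfN (ξ t) i))

end NetworkSystem

end Homogeneous

/-! ### Settling without references and exact tracking. -/

section ClosedLoop

variable {N M p q : ℕ} {sys : NetworkSystem N M p} {ctrl : LocalController sys}
  {Sη : Matrix (Fin q) (Fin q) ℝ} {Bη : Matrix (Fin q) (Fin p) ℝ}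
  {Qη Qv : Matrix (Fin p) (Fin q) ℝ} {ε : ℝ}
  {x x₁ : ℝ → ∀ i, Fin (sys.n i) → ℝ} {z z₁ : ℝ → ∀ j, Fin (sys.ne j) → ℝ}
  {ηbar ηbar₁ : ℝ → Fin N → Fin p × Fin q → ℝ} {ζ ζ₁ : ℝ → ∀ i, Fin (ctrl.c i) → ℝ}
  {ν ν₁ : ℝ → Fin N → Fin q → ℝ}

theorem NetworkSystem.neighboringInput_sub (sys : NetworkSystem N M p)
    (a b : ∀ j, Fin (sys.ne j) → ℝ) (i : Fin N) :
    sys.neighboringInput (a - b) i = sys.neighboringInput a i - sys.neighboringInput b i := by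
  simp only [NetworkSystem.neighboringInput, NetworkSystem.edgeOutput, Pi.sub_apply, mulVec_sub,
    smul_sub, Finset.sum_sub_distrib]
  abel

theorem NetworkSystem.sum_neighboringInput (sys : NetworkSystem N M p)
    (a : ∀ j, Fin (sys.ne j) → ℝ) : ∑ i, sys.neighboringInput a i = 0 := by
  simp only [NetworkSystem.neighboringInput, Finset.sum_neg_distrib]
  rw [Finset.sum_comm]
  simp only [← Finset.sum_smul, NetworkSystem.sum_H, zero_smul, Finset.sum_const_zero, neg_zero]

theorem NetworkSystem.edgeInput_sub (sys : NetworkSystem N M p)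
    (a b : ∀ i, Fin (sys.n i) → ℝ) (j : Fin M) :
    sys.edgeInput (a - b) j = sys.edgeInput a j - sys.edgeInput b j := by
  simp only [NetworkSystem.edgeInput, NetworkSystem.nodeOutput, Pi.sub_apply, mulVec_sub,
    smul_sub, Finset.sum_sub_distrib]

theorem IsClosedLoopTrajectory.sub
    (h : IsClosedLoopTrajectory sys ctrl Sη Bη Qη Qv ε x z ηbar ζ ν)
    (h₁ : IsClosedLoopTrajectory sys ctrl Sη Bη Qη Qv ε x₁ z₁ ηbar₁ ζ₁ ν₁) :
    IsClosedLoopTrajectory sys ctrl Sη Bη Qη Qv ε (x - x₁) (z - z₁) (ηbar - ηbar₁) (ζ - ζ₁)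
      (ν - ν₁) where
  node i t ht := by
    refine ((h.node i t ht).sub (h₁.node i t ht)).congr_deriv ?_
    simp only [Pi.sub_apply, NetworkSystem.neighboringInput_sub, mulVec_sub, mulVec_add]
    abel
  edge j t ht := by
    refine ((h.edge j t ht).sub (h₁.edge j t ht)).congr_deriv ?_
    simp only [Pi.sub_apply, NetworkSystem.edgeInput_sub, mulVec_sub]
    abel
  outputReference i t ht := by
    refine ((h.outputReference i t ht).sub (h₁.outputReference i t ht)).congr_deriv ?_
    simp only [Pi.sub_apply, NetworkSystem.neighboringInput_sub, mulVec_sub, smul_sub]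
    abel
  internalModel i t ht := by
    refine ((h.internalModel i t ht).sub (h₁.internalModel i t ht)).congr_deriv ?_
    simp only [Pi.sub_apply, NetworkSystem.nodeOutput, mulVec_sub]
    abel
  inputReference i t ht := by
    refine ((h.inputReference i t ht).sub (h₁.inputReference i t ht)).congr_deriv ?_
    simp only [Pi.sub_apply, mulVec_sub]

theorem HasDerivWithinAt.sumElim {ι κ : Type*} [Fintype ι] [Fintype κ] {f : ℝ → ι → ℝ}
    {g : ℝ → κ → ℝ} {f' : ι → ℝ} {g' : κ → ℝ} {s : Set ℝ} {t : ℝ}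
    (hf : HasDerivWithinAt f f' s t) (hg : HasDerivWithinAt g g' s t) :
    HasDerivWithinAt (fun τ => Sum.elim (f τ) (g τ)) (Sum.elim f' g') s t := by
  refine hasDerivWithinAt_pi.2 ?_
  rintro (a | a)
  · exact hasDerivWithinAt_pi.1 hf a
  · exact hasDerivWithinAt_pi.1 hg a

theorem aeval_modelS_minpoly (p : ℕ) (S : Matrix (Fin q) (Fin q) ℝ) :
    Polynomial.aeval (modelS p S) (minpoly ℝ S) = 0 := by
  rw [modelS, aeval_one_kronecker, minpoly.aeval]
  ext i j
  simp [kroneckerMap_apply]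

/-- Without input references, every closed-loop trajectory settles for a small gain. -/
theorem LocalController.Passifies.eventually_tendsto_zero {Pη : Matrix (Fin q) (Fin q) ℝ}
    (hA5 : ctrl.Passifies) (hA2 : HasSimpleImaginarySpectrum Sη)
    (hA3 : ∀ j, IsStrictlyPositiveReal (sys.E j) (sys.F j) (sys.G j))
    (hIM : ∀ i, IncorporatesPCopy Sη (ctrl.G₁ i) (ctrl.G₂ i)) (hPη : Pη.PosDef)
    (hGS : (-(((1 : Matrix (Fin p) (Fin p) ℝ) ⊗ₖ Pη) * modelS p Sη
      + (modelS p Sη)ᵀ * ((1 : Matrix (Fin p) (Fin p) ℝ) ⊗ₖ Pη))).PosSemidef)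
    (hGB : ((1 : Matrix (Fin p) (Fin p) ℝ) ⊗ₖ Pη) * modelB Bη = (modelQ Qη)ᵀ)
    (Qv : Matrix (Fin p) (Fin q) ℝ) :
    ∀ᶠ ε : ℝ in 𝓝[>] 0, ∀ (x : ℝ → ∀ i, Fin (sys.n i) → ℝ)
      (z : ℝ → ∀ j, Fin (sys.ne j) → ℝ) (ηbar : ℝ → Fin N → Fin p × Fin q → ℝ)
      (ζ : ℝ → ∀ i, Fin (ctrl.c i) → ℝ) (ν : ℝ → Fin N → Fin q → ℝ),
      IsClosedLoopTrajectory sys ctrl Sη Bη Qη Qv ε x z ηbar ζ ν → (∀ t, ν t = 0) →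
      (∀ i, Tendsto (fun t => sys.nodeOutput (x t) i - modelQ Qη *ᵥ ηbar t i) atTop (𝓝 0)) ∧
      ∀ i, Tendsto (fun t => sys.neighboringInput (z t) i) atTop (𝓝 0) := by
  -- These are the steady states of node and controller when `ηbar` follows its free dynamics and no
  -- input acts. In the coordinates `x - X ηbar`, `ζ - Z ηbar`, the adaptation of `ηbar` appears
  -- only as `-ε R v`, with `R` made of `X G_B` and `Z G_B`.
  have hreg := fun i => exists_regulator (hIM i) (f := (ctrl.hatA i).charpoly)
    (aeval_self_charpoly (ctrl.hatA i)) (isCoprime_charpoly_minpoly (hA5 i).1 hA2)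
    (aeval_modelS_minpoly p Sη) 0 (modelQ Qη)
  choose X Z hX hZ hC using hreg
  have hmain := sys.eventually_tendsto_zero hA3
    (R := fun i => fromRows (X i * modelB Bη) (Z i * modelB Bη)) (fun i => (hA5 i).1)
    (fun i => (hA5 i).2) (posDef_one_kronecker hPη) hGS hGB
  filter_upwards [hmain] with ε hε x z ηbar ζ ν h hν
  have hy : ∀ t i, ctrl.hatC i *ᵥ Sum.elim (x t i - X i *ᵥ ηbar t i) (ζ t i - Z i *ᵥ ηbar t i)
      = sys.nodeOutput (x t) i - modelQ Qη *ᵥ ηbar t i := by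
    intro t i
    rw [LocalController.hatC, fromCols_mulVec_sumElim, zero_mulVec, add_zero, mulVec_sub,
      mulVec_mulVec, hC, NetworkSystem.nodeOutput]
  obtain ⟨h1, h2⟩ : (∀ i, Tendsto (fun t =>
      Sum.elim (x t i - X i *ᵥ ηbar t i) (ζ t i - Z i *ᵥ ηbar t i)) atTop (𝓝 0)) ∧
      ∀ j, Tendsto (fun t => z t j) atTop (𝓝 0) := by
    refine hε (fun t i => Sum.elim (x t i - X i *ᵥ ηbar t i) (ζ t i - Z i *ᵥ ηbar t i)) z ηbar
      ?_ ?_ ?_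
    · intro i t ht
      have hη := h.outputReference i t ht
      have hd1 := (h.node i t ht).sub (hη.matrix_mulVec (X i))
      have hd2 := (h.internalModel i t ht).sub (hη.matrix_mulVec (Z i))
      refine (hd1.sumElim hd2).congr_deriv ?_
      simp only [LocalController.hatA, LocalController.hatD, fromBlocks_mulVec,
        fromRows_mulVec, hν, Pi.zero_apply, mulVec_zero, sub_zero, zero_mulVec]
      simp only [Sum.elim_comp_inl, Sum.elim_comp_inr]
      have e1 : X i *ᵥ (modelS p Sη *ᵥ ηbar t i) = (sys.A i * X i
          + sys.B i * (ctrl.Kx i * X i + ctrl.Kζ i * Z i)) *ᵥ ηbar t i := by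
        rw [mulVec_mulVec, hX, add_zero]
      have e2 : Z i *ᵥ (modelS p Sη *ᵥ ηbar t i) = (ctrl.G₁ i * Z i) *ᵥ ηbar t i := by
        rw [mulVec_mulVec, hZ]
      have e3 : modelQ Qη *ᵥ ηbar t i = sys.C i *ᵥ (X i *ᵥ ηbar t i) := by
        rw [mulVec_mulVec, hC]
      ext (a | a)
      · simp only [Sum.elim_inl, Pi.sub_apply, Pi.add_apply, Pi.smul_apply]
        simp only [mulVec_add, mulVec_smul, e1, mulVec_sub, add_mulVec, ← mulVec_mulVec,
          Pi.sub_apply, Pi.add_apply, Pi.smul_apply, smul_eq_mul]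
        ring
      · simp only [Sum.elim_inr, Pi.sub_apply, Pi.add_apply, Pi.smul_apply, Pi.zero_apply]
        simp only [mulVec_add, mulVec_smul, e2, e3, mulVec_sub, ← mulVec_mulVec,
          NetworkSystem.nodeOutput,
          Pi.sub_apply, Pi.add_apply, Pi.smul_apply, smul_eq_mul]
        ring
    · intro j t ht
      refine (h.edge j t ht).congr_deriv ?_
      simp only [hy, sub_add_cancel, NetworkSystem.edgeInput]
    · intro i t ht
      refine (h.outputReference i t ht).congr_deriv ?_
      simp only [hν, Pi.zero_apply, mulVec_zero, sub_zero]
  refine ⟨fun i => ?_, fun i => ?_⟩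
  · have hcont : Continuous fun a => ctrl.hatC i *ᵥ a := by fun_prop
    have := (hcont.tendsto 0).comp (h1 i)
    rw [mulVec_zero] at this
    exact this.congr fun t => hy t i
  · have := ((sys.continuous_neighboringInput i).tendsto 0).comp (tendsto_pi_nhds.2 h2)
    have h0 : sys.neighboringInput 0 i = 0 := by
      simpa using sys.neighboringInput_smul 0 0 i
    rw [h0] at this
    exact this

/-- References of zero sum are tracked exactly by some closed-loop trajectory. -/
theorem exists_reference_trajectory {Pη : Matrix (Fin q) (Fin q) ℝ} (hp : 0 < p)
    (hA1 : sys.FullRank) (hA2 : HasSimpleImaginarySpectrum Sη)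
    (hA3 : ∀ j, IsStrictlyPositiveReal (sys.E j) (sys.F j) (sys.G j)) (hA4 : sys.Connected)
    (hIM : ∀ i, IncorporatesPCopy Sη (ctrl.G₁ i) (ctrl.G₂ i)) (hA5 : ctrl.Passifies)
    (hPη : Pη.PosDef) (hGctrb : IsControllable (modelS p Sη) (modelB Bη))
    (hGS : (-(((1 : Matrix (Fin p) (Fin p) ℝ) ⊗ₖ Pη) * modelS p Sη
      + (modelS p Sη)ᵀ * ((1 : Matrix (Fin p) (Fin p) ℝ) ⊗ₖ Pη))).PosSemidef)
    (hGB : ((1 : Matrix (Fin p) (Fin p) ℝ) ⊗ₖ Pη) * modelB Bη = (modelQ Qη)ᵀ)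
    (Qv : Matrix (Fin p) (Fin q) ℝ) (ε : ℝ)
    (hν : ∀ i, ∀ t ≥ 0, HasDerivWithinAt (fun τ => ν τ i) (Sη *ᵥ ν t i) (Set.Ici 0) t)
    (hsum : ∀ t ≥ 0, ∑ i, ν t i = 0) :
    ∃ (x : ℝ → ∀ i, Fin (sys.n i) → ℝ) (z : ℝ → ∀ j, Fin (sys.ne j) → ℝ)
      (ηbar : ℝ → Fin N → Fin p × Fin q → ℝ) (ζ : ℝ → ∀ i, Fin (ctrl.c i) → ℝ),
      IsClosedLoopTrajectory sys ctrl Sη Bη Qη Qv ε x z ηbar ζ ν ∧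
      (∀ t ≥ 0, ∀ i, sys.neighboringInput (z t) i = Qv *ᵥ ν t i) ∧
      ∀ t i, sys.nodeOutput (x t) i = modelQ Qη *ᵥ ηbar t i := by
  have hN : (N : ℝ) ≠ 0 := Nat.cast_ne_zero.2 hA4.pos.ne'
  have hPS := lyapunov_equality_of_model hp hPη hA2 hGS
  -- `b k i` is the share of `ν k` in the input of node `i`. Subtracting the mean gives each `b k`
  -- zero sum over the nodes, as the network requires, and changes nothing in total because the
  -- references themselves sum to zero.
  let b : Fin N → Fin N → Matrix (Fin p) (Fin q) ℝ :=
    fun k i => ((if k = i then (1 : ℝ) else 0) - (N : ℝ)⁻¹) • Qv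
  have hb : ∀ k, ∑ i, b k i = 0 := by
    intro k
    simp only [b, ← Finset.sum_smul]
    simp [hN]
  choose Y Z hZ hv using fun k =>
    sys.exists_edge_steadyState hPη hPS (fun j => (hA1.2 j).1) hA3 hA4 (b k) (hb k)
  -- The adaptation term vanishes on the exact solution, so `ηbar` must run freely and still output
  -- `Y`; any `ε` is then admissible.
  choose W hW hWY using fun k i => exists_model_realization hPη hPS hGctrb hGB (Y k i)
  choose X Zc hX hZc hC using fun k i => exists_regulator (hIM i) (f := (ctrl.hatA i).charpoly)
    (aeval_self_charpoly (ctrl.hatA i)) (isCoprime_charpoly_minpoly (hA5 i).1 hA2)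
    (minpoly.aeval ℝ Sη) (sys.D i * b k i) (Y k i)
  have hder : ∀ {o : Type} [Fintype o] (L : Fin N → Matrix o (Fin q) ℝ), ∀ t ≥ 0,
      HasDerivWithinAt (fun τ => ∑ k, L k *ᵥ ν τ k) (∑ k, (L k * Sη) *ᵥ ν t k) (Set.Ici 0) t := by
    intro o _ L t ht
    refine (HasDerivWithinAt.fun_sum fun k _ => (hν k t ht).matrix_mulVec (L k)).congr_deriv ?_
    simp only [mulVec_mulVec]
  have hin : ∀ t i, sys.neighboringInput (fun j => ∑ k, Z k j *ᵥ ν t k) i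
      = ∑ k, b k i *ᵥ ν t k := by
    intro t i
    simp only [← hv, NetworkSystem.neighboringInput, NetworkSystem.edgeOutput, mulVec_sum,
      mulVec_mulVec, neg_mulVec, sum_mulVec, smul_mulVec, Finset.smul_sum, Finset.sum_neg_distrib]
    rw [Finset.sum_comm]
  have hout : ∀ t i, sys.nodeOutput (fun i => ∑ k, X k i *ᵥ ν t k) i = ∑ k, Y k i *ᵥ ν t k := by
    intro t i
    simp only [NetworkSystem.nodeOutput, mulVec_sum, mulVec_mulVec, hC]
  have hQ : ∀ t i, modelQ Qη *ᵥ (∑ k, W k i *ᵥ ν t k) = ∑ k, Y k i *ᵥ ν t k := by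
    intro t i
    simp only [mulVec_sum, mulVec_mulVec, hWY]
  have hinQ : ∀ t ≥ 0, ∀ i, sys.neighboringInput (fun j => ∑ k, Z k j *ᵥ ν t k) i
      = Qv *ᵥ ν t i := by
    intro t ht i
    rw [hin]
    have hk : ∀ k, b k i *ᵥ ν t k
        = (if k = i then Qv *ᵥ ν t k else 0) - (N : ℝ)⁻¹ • (Qv *ᵥ ν t k) := by
      intro k
      split_ifs with hki <;> simp [b, hki, sub_smul, sub_mulVec, neg_mulVec, smul_mulVec]
    simp only [hk, Finset.sum_sub_distrib, Finset.sum_ite_eq', Finset.mem_univ, if_true,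
      ← Finset.smul_sum, ← mulVec_sum, hsum t ht, mulVec_zero, smul_zero, sub_zero]
  refine ⟨fun t i => ∑ k, X k i *ᵥ ν t k, fun t j => ∑ k, Z k j *ᵥ ν t k,
    fun t i => ∑ k, W k i *ᵥ ν t k, fun t i => ∑ k, Zc k i *ᵥ ν t k, ⟨?_, ?_, ?_, ?_, hν⟩,
    hinQ, fun t i => by rw [hout, hQ]⟩
  · intro i t ht
    refine (hder (fun k => X k i) t ht).congr_deriv ?_
    rw [hin]
    simp only [hX, mulVec_sum, mulVec_mulVec, add_mulVec, Matrix.mul_add, mulVec_add,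
      Finset.sum_add_distrib]
  · intro j t ht
    refine (hder (fun k => Z k j) t ht).congr_deriv ?_
    simp only [hZ, NetworkSystem.edgeInput, hout, mulVec_sum, mulVec_mulVec, add_mulVec,
      Finset.sum_add_distrib, Finset.smul_sum, Matrix.mul_sum, sum_mulVec, Matrix.mul_smul,
      smul_mulVec, mulVec_smul]
    congr 1
    rw [Finset.sum_comm]
  · intro i t ht
    refine (hder (fun k => W k i) t ht).congr_deriv ?_
    rw [hinQ t ht, sub_self, mulVec_zero, smul_zero, add_zero]
    simp only [← hW, mulVec_sum, mulVec_mulVec]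
  · intro i t ht
    refine (hder (fun k => Zc k i) t ht).congr_deriv ?_
    rw [hout, hQ, sub_self, mulVec_zero, add_zero]
    simp only [hZc, mulVec_sum, mulVec_mulVec]

end ClosedLoop

/-! ### Free linear evolution and the matrix exponential. -/

section Exponential

open scoped Matrix.Norms.Operator

theorem Matrix.hasDerivAt_exp_smul_mulVec {ι : Type*} [Fintype ι] [DecidableEq ι]
    (A : Matrix ι ι ℝ) (v : ι → ℝ) (t : ℝ) :
    HasDerivAt (fun τ : ℝ => NormedSpace.exp (τ • A) *ᵥ v)
      (A *ᵥ (NormedSpace.exp (t • A) *ᵥ v)) t := by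
  have h1 := hasDerivAt_exp_smul_const' (𝕂 := ℝ) A t
  have h2 := (LinearMap.toContinuousLinearMap ((mulVecBilin ℝ ℝ).flip v)).hasFDerivAt.comp_hasDerivAt
    t h1
  rw [mulVec_mulVec]
  exact h2

theorem eq_exp_mulVec_of_hasDerivWithinAt {ι : Type*} [Fintype ι] [DecidableEq ι]
    {A : Matrix ι ι ℝ} {x : ℝ → ι → ℝ}
    (hx : ∀ t ≥ 0, HasDerivWithinAt x (A *ᵥ x t) (Set.Ici 0) t) {t : ℝ} (ht : 0 ≤ t) :
    x t = NormedSpace.exp (t • A) *ᵥ x 0 := by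
  let L : (ι → ℝ) →L[ℝ] (ι → ℝ) := LinearMap.toContinuousLinearMap A.mulVecLin
  have huniq := ODE_solution_unique_of_mem_Icc_right (v := fun _ y => L y) (s := fun _ => Set.univ)
    (f := x) (g := fun τ => NormedSpace.exp (τ • A) *ᵥ x 0) (a := 0) (b := t) (K := ‖L‖₊)
    (fun _ _ => L.lipschitz.lipschitzOnWith) ?_ ?_ (fun _ _ => Set.mem_univ _) ?_ ?_
    (fun _ _ => Set.mem_univ _) (by simp)
  · exact huniq ⟨ht, le_rfl⟩
  · exact fun s hs => ((hx s hs.1).mono fun r hr => hr.1).continuousWithinAt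
  · exact fun s hs => (hx s hs.1).mono fun r hr => hs.1.trans hr
  · exact fun s _ => (hasDerivAt_exp_smul_mulVec A (x 0) s).continuousAt.continuousWithinAt
  · exact fun s _ => (hasDerivAt_exp_smul_mulVec A (x 0) s).hasDerivWithinAt

end Exponential

/-! ### Output cooperation. -/

theorem mainTheorem1 {N M p q : ℕ} (sys : NetworkSystem N M p) (ctrl : LocalController sys)
    (Sη Pη : Matrix (Fin q) (Fin q) ℝ) (Bη : Matrix (Fin q) (Fin p) ℝ)
    (Qη Qv : Matrix (Fin p) (Fin q) ℝ)
    (hA1 : sys.FullRank)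
    (hA2 : HasSimpleImaginarySpectrum Sη)
    (hA3 : ∀ j, IsStrictlyPositiveReal (sys.E j) (sys.F j) (sys.G j))
    (hA4 : sys.Connected)
    (hIM : ∀ i, IncorporatesPCopy Sη (ctrl.G₁ i) (ctrl.G₂ i))
    (hA5 : ctrl.Passifies)
    (hPη : Pη.PosDef)
    (hGctrb : IsControllable (modelS p Sη) (modelB Bη))
    (hGcopy : IncorporatesPCopy Sη (modelS p Sη) (modelB Bη))
    (hGS : (-(((1 : Matrix (Fin p) (Fin p) ℝ) ⊗ₖ Pη) * modelS p Sη
      + (modelS p Sη)ᵀ * ((1 : Matrix (Fin p) (Fin p) ℝ) ⊗ₖ Pη))).PosSemidef)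
    (hGB : ((1 : Matrix (Fin p) (Fin p) ℝ) ⊗ₖ Pη) * modelB Bη = (modelQ Qη)ᵀ) :
    ∃ εstar : ℝ, 0 < εstar ∧ ∀ ε : ℝ, 0 < ε → ε < εstar →
      ∀ (x : ℝ → ∀ i, Fin (sys.n i) → ℝ) (z : ℝ → ∀ j, Fin (sys.ne j) → ℝ)
        (ηbar : ℝ → Fin N → Fin p × Fin q → ℝ) (ζ : ℝ → ∀ i, Fin (ctrl.c i) → ℝ)
        (ν : ℝ → Fin N → Fin q → ℝ),
        IsClosedLoopTrajectory sys ctrl Sη Bη Qη Qv ε x z ηbar ζ ν →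
        (∀ t ≥ 0, ∑ i, ν t i = 0) →
        (∀ i, Tendsto (fun t => sys.neighboringInput (z t) i - Qv *ᵥ ν t i) atTop (𝓝 0)) ∧
        Tendsto (fun t => (∑ i, sys.nodeOutput (x t) i)
          - modelQ Qη *ᵥ (NormedSpace.exp (t • modelS p Sη) *ᵥ ∑ i, ηbar 0 i)) atTop (𝓝 0) := by
  -- For `p = 0` both limits live in a trivial space, while the Lyapunov equality for `Sη` needs at
  -- least one copy.
  rcases Nat.eq_zero_or_pos p with rfl | hp
  · refine ⟨1, one_pos, fun ε _ _ x z ηbar ζ ν _ _ => ⟨fun i => ?_, ?_⟩⟩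
    · exact tendsto_const_nhds.congr fun t => Subsingleton.elim _ _
    · exact tendsto_const_nhds.congr fun t => Subsingleton.elim _ _
  obtain ⟨εstar, hε0, hε⟩ := (nhdsGT_basis (0 : ℝ)).eventually_iff.1
    (hA5.eventually_tendsto_zero hA2 hA3 hIM hPη hGS hGB Qv)
  refine ⟨εstar, hε0, fun ε hpos hlt x z ηbar ζ ν h hsum => ?_⟩
  obtain ⟨x₁, z₁, ηbar₁, ζ₁, h₁, hv₁, hy₁⟩ := exists_reference_trajectory hp hA1 hA2 hA3 hA4 hIM
    hA5 hPη hGctrb hGS hGB Qv ε h.inputReference hsum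
  obtain ⟨hy, hv⟩ := hε ⟨hpos, hlt⟩ _ _ _ _ _ (h.sub h₁) fun t => sub_self (ν t)
  refine ⟨fun i => (hv i).congr' ?_, ?_⟩
  · filter_upwards [eventually_ge_atTop 0] with t ht
    rw [Pi.sub_apply, NetworkSystem.neighboringInput_sub, hv₁ t ht]
  -- The neighboring inputs sum to zero by the incidence structure and the references by assumption,
  -- so the summed reference model is undriven.
  · have hη : ∀ t ≥ 0, HasDerivWithinAt (fun τ => ∑ i, ηbar τ i)
        (modelS p Sη *ᵥ ∑ i, ηbar t i) (Set.Ici 0) t := by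
      intro t ht
      refine (HasDerivWithinAt.fun_sum fun i _ => h.outputReference i t ht).congr_deriv ?_
      rw [Finset.sum_add_distrib, ← mulVec_sum, ← Finset.smul_sum, ← mulVec_sum,
        Finset.sum_sub_distrib, NetworkSystem.sum_neighboringInput, ← mulVec_sum, hsum t ht]
      simp
    have hlim : Tendsto (fun t => ∑ i, (sys.nodeOutput ((x - x₁) t) i
        - modelQ Qη *ᵥ (ηbar - ηbar₁) t i)) atTop (𝓝 0) := by
      simpa using tendsto_finsetSum Finset.univ fun i _ => hy i
    refine hlim.congr' ?_
    filter_upwards [eventually_ge_atTop 0] with t ht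
    rw [← eq_exp_mulVec_of_hasDerivWithinAt hη ht, mulVec_sum, ← Finset.sum_sub_distrib]
    refine Finset.sum_congr rfl fun i _ => ?_
    have h1 := hy₁ t i
    simp only [NetworkSystem.nodeOutput] at h1 ⊢
    simp only [Pi.sub_apply, mulVec_sub, h1]
    abel
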